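/- Let $\pi/2\le a<\pi$, and let $\{n_{k,1}\}_{k\in\mathbb Z}$, $\{n_{k,2}\}_{k\in\mathbb Z}$ be strictly increasing sequences of integers. For complex-valued functions $p,q\in L_2(0,\pi)$ vanishing a.e. on $(0,a)$ and for $j\in\{1,2\}$, let ${\cal B}_{1,j}(p,q)$ denote the boundary value problem $$ \begin{bmatrix}0&1\\-1&0\end{bmatrix}y'(x)+\begin{bmatrix}q(x)&p(x)\\p(x)&-q(x)\end{bmatrix}y(x-a)=\lambda y(x),\quad 0<x<\pi,\qquad y_1(0)=y_j(\pi)=0, $$ where $y=(y_1,y_2)^T$ is absolutely continuous on $[0,\pi]$. The multiplicity of an eigenvalue is its order as a zero of the characteristic function $\Delta_j(\lambda)=y_j(\pi,\lambda)$, where $y(\cdot,\lambda)$ is the solution with $y(0,\lambda)=(0,1)^T$. An enumeration $\{\lambda_{n,j}\}_{n\in\mathbb Z}$ of the spectrum of ${\cal B}_{1,j}(p,q)$ lists the eigenvalues, repeated according to multiplicity, so that $$ \lambda_{n,j}=n+\frac{1-j}{2}+\varkappa_{n,j},\qquad \{\varkappa_{n,j}\}_{n\in\mathbb Z}\in l_2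 ; $$ a sequence $\{\mu_k\}_{k\in\mathbb Z}$ is called a subspectrum of ${\cal B}_{1,j}(p,q)$ along $\{n_{k,j}\}$ if $\mu_k=\lambda_{n_{k,j},j}$, $k\in\mathbb Z$, for some such enumeration. Let $p,q$ be as above, and for $j=1,2$ let $\{\mu_{k,j}\}_{k\in\mathbb Z}$ be a subspectrum of ${\cal B}_{1,j}(p,q)$ along $\{n_{k,j}\}$. Then these two subspectra determine $p$ and $q$ uniquely (that is, any $\tilde p,\tilde q\in L_2(0,\pi)$ vanishing a.e. on $(0,a)$ such that $\{\mu_{k,j}\}_{k\in\mathbb Z}$ is a subspectrum of ${\cal B}_{1,j}(\tilde p,\tilde q)$ along $\{n_{k,j}\}$ for $j=1,2$ satisfy $\tilde p=p$ and $\tilde q=q$ a.e. on $(0,\pi)$) if and only if for each $j=1,2$ the system $\{\exp(in_{k,j}x)\}_{k\in\mathbb Z}$ is complete in $L_2(a-\pi,\pi-a)$, i.e. its linear span is dense there. -/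

import Mathlib

open MeasureTheory Set

namespace DelayDirac

/-- A complex potential in `L₂(0, π)` that vanishes almost everywhere on `(0, a)`. -/
def IsPotential (a : ℝ) (f : ℝ → ℂ) : Prop :=
  MemLp f 2 (volume.restrict (Ioo 0 Real.pi)) ∧
    ∀ᵐ x ∂(volume.restrict (Ioo 0 a)), f x = 0

/-- The constant matrix `B` of the Dirac system. -/
def B : Matrix (Fin 2) (Fin 2) ℂ := !![0, 1; -1, 0]

/-- The potential matrix `Q(x)`, with `q = q₁₁ = -q₂₂` and `p = q₁₂ = q₂₁`. -/
def Q (p q : ℝ → ℂ) (x : ℝ) : Matrix (Fin 2) (Fin 2) ℂ := !![q x, p x; p x, -q x]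

/-- `y` is an (absolutely continuous) solution of
`B y'(x) + Q(x) y(x - a) = lam y(x)`, `0 < x < π`.  Since `Q = 0` a.e. on `(0, a)`, the values
of `y` outside `[0, π]` play no role. -/
def IsSolution (a : ℝ) (p q : ℝ → ℂ) (lam : ℂ) (y : ℝ → Fin 2 → ℂ) : Prop :=
  AbsolutelyContinuousOnInterval y 0 Real.pi ∧
    ∀ᵐ x ∂(volume.restrict (Ioo 0 Real.pi)), ∃ y' : Fin 2 → ℂ,
      HasDerivAt y y' x ∧
        B.mulVec y' + (Q p q x).mulVec (y (x - a)) = lam • y x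

/-- `lam` is an eigenvalue of the boundary value problem with the boundary conditions
`y₁(0) = 0` and `y₁(π) = 0` (for `j = 0`), respectively `y₁(0) = 0` and `y₂(π) = 0`
(for `j = 1`). -/
def IsEigenvalue (a : ℝ) (p q : ℝ → ℂ) (j : Fin 2) (lam : ℂ) : Prop :=
  ∃ y : ℝ → Fin 2 → ℂ, IsSolution a p q lam y ∧ (∃ x ∈ Icc 0 Real.pi, y x ≠ 0) ∧
    y 0 0 = 0 ∧ y Real.pi j = 0

/-- `Δ` is the characteristic function of that boundary value problem: `Δ(lam) = y_j(π)`, where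
`y` is the solution with `y(0) = (0, 1)`. -/
def IsCharFun (a : ℝ) (p q : ℝ → ℂ) (j : Fin 2) (Δ : ℂ → ℂ) : Prop :=
  ∀ lam : ℂ, ∃ y : ℝ → Fin 2 → ℂ, IsSolution a p q lam y ∧ y 0 = ![0, 1] ∧
    Δ lam = y Real.pi j

/-- `lam` enumerates the spectrum of the boundary value problem: its values are exactly the
eigenvalues, each one repeated according to its multiplicity as a zero of the characteristic
function, and the numbering is such that `lam n = n - j / 2 + ϰ n` with `ϰ ∈ l₂`
(here `j = 0, 1`). -/
def IsSpectrum (a : ℝ) (p q : ℝ → ℂ) (j : Fin 2) (lam : ℤ → ℂ) : Prop :=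
  (∀ z : ℂ, IsEigenvalue a p q j z ↔ z ∈ range lam) ∧
  (∃ Δ : ℂ → ℂ, IsCharFun a p q j Δ ∧
    ∀ z : ℂ, {n : ℤ | lam n = z}.encard = analyticOrderAt Δ z) ∧
  Memℓp (fun n : ℤ => lam n - ((n : ℂ) - ((j : ℕ) : ℂ) / 2)) 2

/-- `μ k = lam (n k)`, where `lam` enumerates the spectrum of the boundary value problem. -/
def IsSubspectrum (a : ℝ) (p q : ℝ → ℂ) (j : Fin 2) (n : ℤ → ℤ) (μ : ℤ → ℂ) : Prop :=
  ∃ lam : ℤ → ℂ, IsSpectrum a p q j lam ∧ ∀ k : ℤ, μ k = lam (n k)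

theorem memLp_exp (a : ℝ) (m : ℤ) :
    MemLp (fun x : ℝ => Complex.exp (Complex.I * m * x)) 2
      (volume.restrict (Ioo (a - Real.pi) (Real.pi - a))) := by
  refine MemLp.of_bound (C := 1) ?_ ?_
  · exact (by fun_prop : Continuous fun x : ℝ =>
      Complex.exp (Complex.I * m * x)).aestronglyMeasurable
  · refine Filter.Eventually.of_forall fun x => ?_
    rw [Complex.norm_exp]
    simp

/-- The function `exp(i m x)` as an element of `L₂(a - π, π - a)`. -/
noncomputable def expL2 (a : ℝ) (m : ℤ) :
    Lp ℂ 2 (volume.restrict (Ioo (a - Real.pi) (Real.pi - a))) :=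
  (memLp_exp a m).toLp _

/-- The system `{exp(i n_k x)}` is complete in `L₂(a - π, π - a)`: its linear span is dense. -/
def IsCompleteExp (a : ℝ) (n : ℤ → ℤ) : Prop :=
  (Submodule.span ℂ (range fun k : ℤ => expL2 a (n k))).topologicalClosure = ⊤

end DelayDirac

/-! Put `Z = y₂ + i y₁`, `W = y₂ - i y₁`, `u = p + i q`, `v = p - i q`. The system becomes `Z' =
-iλZ - u(x) W(x - a)`, `W' = iλW - v(x) Z(x - a)`. Because `a ≥ π/2`, the delayed argument `x - a`
lies in `[0, a]` wherever the potentials live, and there `Z` and `W` are pure exponentials. Hence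
the characteristic functions are affine in the potentials: up to a sign and a shift by `j/2` they
equal `sin πz + ∫ w_j(s) exp(izs) ds` over `(-b, b)` with `b = π - a` (`charFun_eq_sineType`). The
map `(p, q) ↦ (w₀, w₁)` is a linear bijection onto pairs of `L₂` functions, so the two spectra
decouple and each `j` is treated separately.

If two functions `w`, `w'` share the zeros `μ_k`, the sine cancels and the transform of `w - w'`
vanishes at the `μ_k` with multiplicities. The analytic heart is
`exists_ft_vanishing_of_summable_sq`: such zeros of a nonzero transform can be moved by an `l₂`
perturbation without losing nontriviality. Moving `μ_k` to `n_k` gives a nonzero function orthogonal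
to a conjugated exponential system, which completeness forbids.

Conversely, if the exponentials along `n_k` are incomplete, a nonzero transform vanishes at the
`n_k`. Moving its zeros to `μ_k` gives `v ≠ 0` such that `w + v` still produces the zeros `μ_k`. It
remains to number all zeros of the new function so that `μ_k` gets the index `n_k`; a Rouché count
against `sin πz` does this (`exists_isZeroSequence_add`). -/

namespace DelayDirac

open Filter Topology

/-! ### Vector-valued absolutely continuous functions and the fundamental theorem of calculus. -/

section AbsolutelyContinuous

variable {E X Y : Type*} [NormedAddCommGroup E] [NormedSpace ℝ E]

theorem _root_.AbsolutelyContinuousOnInterval.of_dist_le [PseudoMetricSpace X]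
    [PseudoMetricSpace Y] {f : ℝ → X} {g : ℝ → Y} {a b : ℝ}
    (hg : AbsolutelyContinuousOnInterval g a b)
    (h : ∀ x ∈ uIcc a b, ∀ y ∈ uIcc a b, dist (f x) (f y) ≤ dist (g x) (g y)) :
    AbsolutelyContinuousOnInterval f a b := by
  rw [absolutelyContinuousOnInterval_iff] at hg ⊢
  intro ε hε
  obtain ⟨δ, hδ, H⟩ := hg ε hε
  refine ⟨δ, hδ, fun I hI hlt => lt_of_le_of_lt (Finset.sum_le_sum fun i hi => ?_) (H I hI hlt)⟩
  exact h _ (hI.1 i hi).1 _ (hI.1 i hi).2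

/-- The increments of the primitive are dominated by those of the real primitive of `‖f‖`, which
reduces the claim to the scalar case. -/
theorem absolutelyContinuousOnInterval_primitive {f : ℝ → E} {a b c : ℝ}
    (hf : IntervalIntegrable f volume a b) (hc : c ∈ uIcc a b) :
    AbsolutelyContinuousOnInterval (fun x => ∫ t in c..x, f t) a b := by
  refine (hf.norm.absolutelyContinuousOnInterval_intervalIntegral hc).of_dist_le
    fun x hx y hy => ?_
  have hs : ∀ {u v : ℝ}, u ∈ uIcc a b → v ∈ uIcc a b → IntervalIntegrable f volume u v :=
    fun hu hv => hf.mono_set (uIcc_subset_uIcc hu hv)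
  rw [dist_eq_norm, dist_eq_norm,
    intervalIntegral.integral_interval_sub_left (hs hc hx) (hs hc hy),
    intervalIntegral.integral_interval_sub_left (hs hc hx).norm (hs hc hy).norm, Real.norm_eq_abs]
  exact intervalIntegral.norm_integral_le_abs_integral_norm

/-- Subtracting the primitive of `f'` from `f` leaves an absolutely continuous function with
derivative zero almost everywhere, hence a constant. -/
theorem _root_.AbsolutelyContinuousOnInterval.integral_eq_sub [CompleteSpace E]
    {f f' : ℝ → E} {a b : ℝ}
    (hf : AbsolutelyContinuousOnInterval f a b) (hf' : IntervalIntegrable f' volume a b)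
    (h : ∀ᵐ x, x ∈ uIcc a b → HasDerivAt f (f' x) x) :
    ∫ x in a..b, f' x = f b - f a := by
  have hAC := hf.sub (absolutelyContinuousOnInterval_primitive hf' left_mem_uIcc)
  obtain ⟨C, hC⟩ := hAC.const_of_ae_hasDerivAt_zero (by
    filter_upwards [h, hf'.ae_hasDerivAt_integral] with x h1 h2 hx
    simpa using! (h1 hx).sub (h2 hx a left_mem_uIcc))
  have h1 := hC a left_mem_uIcc
  have h2 := hC b right_mem_uIcc
  simp only [Pi.sub_apply, intervalIntegral.integral_same, sub_zero] at h1 h2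
  rw [h1, ← h2]
  abel

end AbsolutelyContinuous

/-- The Fourier transform, at a complex point, of a function on `(-b, b)`. -/
noncomputable def ft (b : ℝ) (w : ℝ → ℂ) (z : ℂ) : ℂ :=
  ∫ s in (-b)..b, w s * Complex.exp (Complex.I * z * s)

/-! ### Fourier transforms of functions supported in `(-b, b)`: analyticity, division by zeros,
Parseval. -/

section FourierTransform

variable {b : ℝ} {w w' : ℝ → ℂ}

theorem ft_congr_ae (h : w =ᵐ[volume.restrict (Ioo (-b) b)] w') (hb : 0 ≤ b) :
    ft b w = ft b w' := by
  ext z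
  simp only [ft]
  rw [intervalIntegral.integral_of_le (by linarith), intervalIntegral.integral_of_le (by linarith),
    ← restrict_Ioo_eq_restrict_Ioc]
  refine integral_congr_ae ?_
  filter_upwards [h] with x hx
  rw [hx]

theorem _root_.IntervalIntegrable.mul_exp (hw : IntervalIntegrable w volume (-b) b) (z : ℂ) :
    IntervalIntegrable (fun s : ℝ => w s * Complex.exp (Complex.I * z * s)) volume (-b) b :=
  hw.mul_continuousOn (by fun_prop)

theorem ft_add (hw : IntervalIntegrable w volume (-b) b)
    (hw' : IntervalIntegrable w' volume (-b) b) (z : ℂ) :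
    ft b (fun s => w s + w' s) z = ft b w z + ft b w' z := by
  simp only [ft, add_mul]
  exact intervalIntegral.integral_add (hw.mul_exp z) (hw'.mul_exp z)

theorem ft_sub (hw : IntervalIntegrable w volume (-b) b)
    (hw' : IntervalIntegrable w' volume (-b) b) (z : ℂ) :
    ft b (fun s => w s - w' s) z = ft b w z - ft b w' z := by
  simp only [ft, sub_mul]
  exact intervalIntegral.integral_sub (hw.mul_exp z) (hw'.mul_exp z)

theorem ft_const_mul (c z : ℂ) : ft b (fun s => c * w s) z = c * ft b w z := by
  simp only [ft, mul_assoc]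
  exact intervalIntegral.integral_const_mul _ _

theorem ft_mul_exp (c z : ℂ) :
    ft b (fun s => w s * Complex.exp (Complex.I * c * s)) z = ft b w (z + c) := by
  simp only [ft, mul_assoc, ← Complex.exp_add]
  congr! 4
  ring

theorem norm_exp_I_mul_le {s : ℝ} (hs : |s| ≤ b) (z : ℂ) :
    ‖Complex.exp (Complex.I * z * s)‖ ≤ Real.exp (b * |z.im|) := by
  rw [Complex.norm_exp, Real.exp_le_exp]
  have : (Complex.I * z * s).re = -(z.im * s) := by simp
  rw [this]
  refine (neg_le_abs _).trans ?_
  rw [abs_mul, mul_comm]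
  gcongr

theorem norm_ft_le (hb : 0 ≤ b) (hw : IntervalIntegrable w volume (-b) b) (z : ℂ) :
    ‖ft b w z‖ ≤ Real.exp (b * |z.im|) * ∫ s in (-b)..b, ‖w s‖ := by
  rw [← intervalIntegral.integral_const_mul]
  refine intervalIntegral.norm_integral_le_of_norm_le (by linarith) (ae_of_all _ fun s hs => ?_)
    (hw.norm.const_mul _)
  rw [norm_mul, mul_comm]
  gcongr
  exact norm_exp_I_mul_le (abs_le.2 ⟨hs.1.le, hs.2⟩) z

theorem hasDerivAt_ft (hb : 0 ≤ b) (hw : IntervalIntegrable w volume (-b) b) (z : ℂ) :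
    HasDerivAt (ft b w) (ft b (fun s => Complex.I * s * w s) z) z := by
  have key := intervalIntegral.hasDerivAt_integral_of_dominated_loc_of_deriv_le
    (μ := volume) (a := -b) (b := b) (s := Metric.ball z 1) (x₀ := z)
    (F := fun x s => w s * Complex.exp (Complex.I * x * s))
    (F' := fun x s => Complex.I * s * w s * Complex.exp (Complex.I * x * s))
    (bound := fun s => b * Real.exp (b * (|z.im| + 1)) * ‖w s‖)
    (Metric.ball_mem_nhds z one_pos)
    (Eventually.of_forall fun x => (hw.mul_exp x).def'.aestronglyMeasurable)
    (hw.mul_exp z)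
    ((IntervalIntegrable.mul_exp (w := fun s : ℝ => Complex.I * s * w s)
      (hw.continuousOn_mul (by fun_prop)) z).def'.aestronglyMeasurable)
    (ae_of_all _ fun s hs x hx => ?_)
    (hw.norm.const_mul _)
    (ae_of_all _ fun s hs x hx => ?_)
  · exact key.2
  · rw [uIoc_of_le (by linarith)] at hs
    have hs' : |s| ≤ b := abs_le.2 ⟨hs.1.le, hs.2⟩
    have hx' : |x.im| ≤ |z.im| + 1 := by
      have h1 : |(x - z).im| ≤ 1 :=
        (Complex.abs_im_le_norm _).trans (by rw [← dist_eq_norm]; exact (Metric.mem_ball.1 hx).le)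
      rw [Complex.sub_im] at h1
      linarith [abs_sub_abs_le_abs_sub x.im z.im]
    have h2 : ‖Complex.exp (Complex.I * x * s)‖ ≤ Real.exp (b * (|z.im| + 1)) :=
      (norm_exp_I_mul_le hs' x).trans (by gcongr)
    rw [norm_mul, norm_mul, norm_mul, Complex.norm_I, one_mul, Complex.norm_real, Real.norm_eq_abs]
    calc |s| * ‖w s‖ * ‖Complex.exp (Complex.I * x * s)‖
        ≤ b * ‖w s‖ * Real.exp (b * (|z.im| + 1)) := by gcongr
      _ = _ := by ring
  · have h1 : HasDerivAt (fun x : ℂ => Complex.I * x * s) (Complex.I * s) x := by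
      simpa using ((hasDerivAt_id x).const_mul Complex.I).mul_const (s : ℂ)
    exact (h1.cexp.const_mul (w s)).congr_deriv (by ring)

theorem IntervalIntegrable.pow_mul (hw : IntervalIntegrable w volume (-b) b) (i : ℕ) :
    IntervalIntegrable (fun s : ℝ => (Complex.I * s) ^ i * w s) volume (-b) b :=
  hw.continuousOn_mul (by fun_prop)

theorem differentiable_ft (hb : 0 ≤ b) (hw : IntervalIntegrable w volume (-b) b) :
    Differentiable ℂ (ft b w) := fun z => (hasDerivAt_ft hb hw z).differentiableAt

theorem analyticAt_ft (hb : 0 ≤ b) (hw : IntervalIntegrable w volume (-b) b) (z : ℂ) :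
    AnalyticAt ℂ (ft b w) z := (differentiable_ft hb hw).analyticAt z

theorem iteratedDeriv_ft (hb : 0 ≤ b) (hw : IntervalIntegrable w volume (-b) b) (i : ℕ) :
    iteratedDeriv i (ft b w) = ft b (fun s => (Complex.I * s) ^ i * w s) := by
  induction i with
  | zero => simp
  | succ i ih =>
    rw [iteratedDeriv_succ, ih]
    ext z
    rw [(hasDerivAt_ft hb (IntervalIntegrable.pow_mul hw i) z).deriv]
    congr 1
    ext s
    ring

theorem intervalIntegrable_of_memLp (hw : MemLp w 2 (volume.restrict (Ioo (-b) b)))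
    (hb : 0 ≤ b) : IntervalIntegrable w volume (-b) b := by
  rw [intervalIntegrable_iff_integrableOn_Ioo_of_le (by linarith)]
  exact hw.integrable one_le_two

/-- **Division by a zero**. -/
theorem exists_ft_eq_sub_mul (hb : 0 ≤ b) (hw : IntervalIntegrable w volume (-b) b) {μ : ℂ}
    (hμ : ft b w μ = 0) :
    ∃ v : ℝ → ℂ, ContinuousOn v (Icc (-b) b) ∧ ∀ z, ft b w z = (z - μ) * ft b v z := by
  have hbb : -b ≤ b := by linarith
  set W : ℝ → ℂ := fun x => ∫ s in (-b)..x, w s * Complex.exp (Complex.I * μ * s) with hW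
  have hAC : AbsolutelyContinuousOnInterval W (-b) b :=
    absolutelyContinuousOnInterval_primitive (hw.mul_exp μ) left_mem_uIcc
  -- `W` vanishes at `-b` by definition and at `b` because `μ` is a zero of the transform, so
  -- integrating by parts leaves no boundary terms and produces the factor `z - μ`.
  refine ⟨fun s => -Complex.I * W s * Complex.exp (Complex.I * (-μ) * s), ?_, fun z => ?_⟩
  · have := hAC.continuousOn
    rw [uIcc_of_le hbb] at this
    exact (continuousOn_const.mul this).mul (by fun_prop)
  · set e : ℝ → ℂ := fun s => Complex.exp (Complex.I * (z - μ) * s) with he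
    have he' : ∀ s : ℝ, HasDerivAt e (Complex.I * (z - μ) * e s) s := by
      intro s
      have h1 : HasDerivAt (fun x : ℝ => Complex.I * (z - μ) * (x : ℂ)) (Complex.I * (z - μ)) s := by
        simpa using (Complex.ofRealCLM.hasDerivAt (x := s)).const_mul (Complex.I * (z - μ))
      convert h1.cexp using 1
      ring
    have heAC : AbsolutelyContinuousOnInterval e (-b) b := by
      refine ContDiffOn.absolutelyContinuousOnInterval (ContDiff.contDiffOn ?_)
      exact (contDiff_const.mul Complex.ofRealCLM.contDiff).cexp
    have hecont : Continuous e := by fun_prop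
    have hWcont := hAC.continuousOn
    have i1 : IntervalIntegrable (fun s => w s * Complex.exp (Complex.I * μ * s) * e s)
        volume (-b) b := (hw.mul_exp μ).mul_continuousOn hecont.continuousOn
    have i2 : IntervalIntegrable (fun s => W s * (Complex.I * (z - μ) * e s)) volume (-b) b :=
      (hWcont.mul (by fun_prop)).intervalIntegrable
    have key := (hAC.smul heAC).integral_eq_sub (i1.add i2) (by
      filter_upwards [(hw.mul_exp μ).ae_hasDerivAt_integral] with x hx hxm
      convert! (hx hxm (-b) left_mem_uIcc).mul (he' x) using 1)
    have h0 : W (-b) = 0 := by simp [hW]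
    have h1 : W b = 0 := hμ
    simp only [Pi.smul_apply', smul_eq_mul, h0, h1, zero_mul, sub_zero] at key
    rw [intervalIntegral.integral_add i1 i2] at key
    have e1 : ft b w z = ∫ s in (-b)..b, w s * Complex.exp (Complex.I * μ * s) * e s := by
      simp only [ft, he, mul_assoc, ← Complex.exp_add]
      congr! 4
      ring
    rw [e1, eq_neg_of_add_eq_zero_left key, ft, ← intervalIntegral.integral_const_mul,
      ← intervalIntegral.integral_neg]
    congr 1
    ext s
    have : e s = Complex.exp (Complex.I * (-μ) * s) * Complex.exp (Complex.I * z * s) := by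
      simp only [he, ← Complex.exp_add]
      congr 1
      ring
    rw [this]
    ring

/-- **Parseval's identity** for the values on the integer points of a horizontal line. -/
theorem hasSum_sq_ft (hb : 0 ≤ b) (hbπ : b ≤ Real.pi)
    (hw : MemLp w 2 (volume.restrict (Ioo (-b) b))) (h : ℝ) :
    HasSum (fun m : ℤ => ‖ft b w (m + h * Complex.I)‖ ^ 2)
      (2 * Real.pi * ∫ s in (-b)..b, (Real.exp (-h * s) * ‖w s‖) ^ 2) := by
  have hπ := Real.pi_pos
  -- The height `h` of the line is absorbed in the weight `exp(-hs)`. Extended by zero to a full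
  -- period, the weighted function has the values of `ft b w` at `-m + ih` as Fourier coefficients,
  -- up to the factor `2π`.
  set f : ℝ → ℂ := (Ioo (-b) b).indicator fun s => w s * Complex.exp (-h * s) with hf
  have hsub : Ioo (-b) b ⊆ Ioc (-Real.pi) Real.pi :=
    fun x hx => ⟨by linarith [hx.1], by linarith [hx.2]⟩
  have hfL : MemLp f 2 (volume.restrict (Ioc (-Real.pi) Real.pi)) := by
    rw [hf, memLp_indicator_iff_restrict measurableSet_Ioo, Measure.restrict_restrict_of_subset hsub]
    have hbd : MemLp (fun s : ℝ => Complex.exp (-h * s)) ⊤ (volume.restrict (Ioo (-b) b)) := by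
      refine memLp_top_of_bound (by fun_prop) (Real.exp (|h| * b)) ?_
      refine (ae_restrict_iff' measurableSet_Ioo).2 (ae_of_all _ fun s hs => ?_)
      rw [Complex.norm_exp, Real.exp_le_exp]
      have h1 : ((-h : ℂ) * s).re = -(h * s) := by simp
      rw [h1]
      refine (neg_le_abs _).trans ?_
      rw [abs_mul]
      gcongr
      exact abs_le.2 ⟨hs.1.le, hs.2.le⟩
    exact hbd.mul hw
  have key := (hasSum_sq_fourierCoeffOn (by linarith) hfL).mul_left ((2 * Real.pi) ^ 2)
  have hind : ∀ {E : Type} [NormedAddCommGroup E] [NormedSpace ℝ E] (φ : ℝ → E),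
      ∫ x in (-Real.pi)..Real.pi, (Ioo (-b) b).indicator φ x = ∫ x in (-b)..b, φ x := by
    intro E _ _ φ
    rw [intervalIntegral.integral_of_le (by linarith), intervalIntegral.integral_of_le (by linarith),
      setIntegral_indicator measurableSet_Ioo, inter_eq_self_of_subset_right hsub,
      integral_Ioc_eq_integral_Ioo]
  have hcoef : ∀ m : ℤ, (2 * Real.pi) ^ 2 * ‖fourierCoeffOn (by linarith : -Real.pi < Real.pi) f m‖ ^ 2
      = ‖ft b w ((-m : ℤ) + h * Complex.I)‖ ^ 2 := by
    intro m
    rw [fourierCoeffOn_eq_integral, ← mul_pow]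
    congr 1
    have e1 : (fun x : ℝ => fourier (-m) (x : AddCircle (Real.pi - -Real.pi)) • f x)
        = (Ioo (-b) b).indicator fun x : ℝ =>
          w x * Complex.exp (Complex.I * ((-m : ℤ) + h * Complex.I) * x) := by
      ext x
      by_cases hx : x ∈ Ioo (-b) b
      · simp only [hf, indicator_of_mem hx, fourier_coe_apply, smul_eq_mul]
        rw [mul_left_comm, ← Complex.exp_add]
        congr 2
        push_cast
        have : (Real.pi : ℂ) ≠ 0 := by exact_mod_cast hπ.ne'
        field_simp
        linear_combination (-2 * x * h : ℂ) * Complex.I_sq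
      · simp [hf, indicator_of_notMem hx]
    rw [e1, hind, norm_smul, ← ft,
      Real.norm_of_nonneg (one_div_nonneg.2 (by linarith)), sub_neg_eq_add, ← two_mul]
    field_simp
  have hnorm : ∫ x in (-Real.pi)..Real.pi, ‖f x‖ ^ 2
      = ∫ s in (-b)..b, (Real.exp (-h * s) * ‖w s‖) ^ 2 := by
    rw [← hind]
    congr 1
    ext x
    by_cases hx : x ∈ Ioo (-b) b
    · simp only [hf, indicator_of_mem hx, norm_mul, Complex.norm_exp]
      rw [mul_comm]
      simp
    · simp [hf, indicator_of_notMem hx]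
  rw [hnorm] at key
  simp only [hcoef] at key
  -- Fourier coefficients carry `exp(-imx)` while `ft` carries `exp(izs)`, so the index is
  -- reflected.
  rw [← (Equiv.neg ℤ).hasSum_iff] at key
  convert key using 1
  · ext m
    simp
  · ext m
    simp
  · rw [smul_eq_mul, sub_neg_eq_add, ← two_mul]
    field_simp

end FourierTransform

end DelayDirac

namespace DelayDirac

open Filter Topology

/-! ### Moving the zeros of a transform: stability of incompleteness under `l₂` perturbations. -/

section Transfer

variable {b : ℝ} {w : ℝ → ℂ}

/-- Parseval controls the weighted norm, and `exp(|h| b) exp(-hs) ≥ 1` on `[-b, b]` removes the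
weight. -/
theorem integral_sq_le_tsum_sq_ft (hb : 0 ≤ b) (hbπ : b ≤ Real.pi)
    (hw : MemLp w 2 (volume.restrict (Ioo (-b) b))) (h : ℝ) :
    ∫ s in (-b)..b, ‖w s‖ ^ 2 ≤
      Real.exp (|h| * b) ^ 2 / (2 * Real.pi) * ∑' m : ℤ, ‖ft b w (m + h * Complex.I)‖ ^ 2 := by
  have hπ := Real.pi_pos
  have hsq : IntervalIntegrable (fun s => ‖w s‖ ^ 2) volume (-b) b := by
    rw [intervalIntegrable_iff_integrableOn_Ioo_of_le (by linarith)]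
    exact hw.integrable_norm_pow two_ne_zero
  rw [(hasSum_sq_ft hb hbπ hw h).tsum_eq, div_mul_eq_mul_div, mul_left_comm,
    mul_div_cancel_left₀ _ (by positivity), ← intervalIntegral.integral_const_mul]
  refine intervalIntegral.integral_mono_on (by linarith) hsq ?_ fun s hs => ?_
  · simp only [mul_pow]
    have hexp : ContinuousOn (fun s : ℝ => Real.exp (-h * s) ^ 2) (uIcc (-b) b) := by fun_prop
    exact (hsq.continuousOn_mul hexp).const_mul _
  · rw [← mul_pow, ← mul_assoc, ← Real.exp_add]
    have h1 : 0 ≤ |h| * b + -h * s := by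
      have : h * s ≤ |h| * b := (le_abs_self _).trans (by
        rw [abs_mul]; gcongr; exact abs_le.2 hs)
      linarith
    have h2 : ‖w s‖ ≤ Real.exp (|h| * b + -h * s) * ‖w s‖ :=
      le_mul_of_one_le_left (norm_nonneg _) (Real.one_le_exp h1)
    gcongr

theorem integral_sq_eq_zero_iff (hb : 0 ≤ b) (hw : MemLp w 2 (volume.restrict (Ioo (-b) b)))
    (h : ∫ s in (-b)..b, ‖w s‖ ^ 2 ≤ 0) : w =ᵐ[volume.restrict (Ioo (-b) b)] 0 := by
  rw [intervalIntegral.integral_of_le (by linarith), integral_Ioc_eq_integral_Ioo] at h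
  have h0 := le_antisymm h (integral_nonneg fun s => by positivity)
  rw [integral_eq_zero_iff_of_nonneg (fun s => by positivity)
    (hw.integrable_norm_pow two_ne_zero)] at h0
  filter_upwards [h0] with x hx
  simpa using hx

theorem ae_eq_zero_of_ft_eq_zero (hb : 0 ≤ b) (hbπ : b ≤ Real.pi)
    (hw : MemLp w 2 (volume.restrict (Ioo (-b) b))) (h : ℝ)
    (h0 : ∀ m : ℤ, ft b w (m + h * Complex.I) = 0) : w =ᵐ[volume.restrict (Ioo (-b) b)] 0 := by
  refine integral_sq_eq_zero_iff hb hw ((integral_sq_le_tsum_sq_ft hb hbπ hw h).trans ?_)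
  simp [h0]

/-- Weak sequential compactness of bounded sets of `L₂(-b, b)`, along arbitrary filters. -/
theorem exists_ultrafilter_tendsto_integral {ι : Type*} {l : Filter ι} [l.NeBot] (hb : 0 ≤ b)
    {v : ι → ℝ → ℂ} (hv : ∀ i, MemLp (v i) 2 (volume.restrict (Ioo (-b) b))) {K : ℝ}
    (hK : ∀ i, ∫ s in (-b)..b, ‖v i s‖ ^ 2 ≤ K) :
    ∃ w : ℝ → ℂ, MemLp w 2 (volume.restrict (Ioo (-b) b)) ∧ ∃ U : Ultrafilter ι, ↑U ≤ l ∧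
      ∀ g : ℝ → ℂ, Continuous g →
        Tendsto (fun i => ∫ s in (-b)..b, v i s * g s) U (𝓝 (∫ s in (-b)..b, w s * g s)) := by
  set M := volume.restrict (Ioo (-b) b)
  -- The `v i` are viewed as functionals through the Riesz isometry, so that Banach–Alaoglu gives a
  -- limit along an ultrafilter. The isometry is conjugate-linear, whence the conjugations below.
  let φ : ι → WeakDual ℂ (Lp ℂ 2 M) := fun i =>
    StrongDual.toWeakDual (InnerProductSpace.toDual ℂ _ ((hv i).toLp (v i)))
  have hball : ∀ i, φ i ∈ WeakDual.toStrongDual ⁻¹'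
      Metric.closedBall (0 : StrongDual ℂ (Lp ℂ 2 M)) (Real.sqrt K) := by
    intro i
    simp only [φ, mem_preimage, mem_closedBall_zero_iff]
    change ‖InnerProductSpace.toDual ℂ _ ((hv i).toLp (v i))‖ ≤ _
    rw [LinearIsometryEquiv.norm_map]
    refine Real.le_sqrt_of_sq_le ?_
    have h1 := hK i
    rw [intervalIntegral.integral_of_le (by linarith), integral_Ioc_eq_integral_Ioo] at h1
    refine le_trans (le_of_eq ?_) h1
    have h2 := L2.inner_def (𝕜 := ℂ) ((hv i).toLp (v i)) ((hv i).toLp (v i))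
    rw [inner_self_eq_norm_sq_to_K] at h2
    have h3 : ∫ s, inner ℂ ((hv i).toLp (v i) s) ((hv i).toLp (v i) s) ∂M
        = ((∫ s, ‖v i s‖ ^ 2 ∂M : ℝ) : ℂ) := by
      rw [← integral_complex_ofReal]
      refine integral_congr_ae ?_
      filter_upwards [(hv i).coeFn_toLp] with s hs
      rw [hs, inner_self_eq_norm_sq_to_K]
      simp
    rw [h3] at h2
    exact Complex.ofReal_injective (by simpa using h2)
  have hcomp := WeakDual.isCompact_closedBall (𝕜 := ℂ) (0 : StrongDual ℂ (Lp ℂ 2 M)) (Real.sqrt K)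
  let U := Ultrafilter.of l
  obtain ⟨ψ, -, hψ⟩ := hcomp.ultrafilter_le_nhds (U.map φ) (by
    rw [le_principal_iff]
    exact Filter.Eventually.of_forall (f := U) hball)
  let w := (InnerProductSpace.toDual ℂ (Lp ℂ 2 M)).symm (WeakDual.toStrongDual ψ)
  refine ⟨w, Lp.memLp w, U, Ultrafilter.of_le l, fun g hg => ?_⟩
  have hgc : MemLp (fun s => (starRingEnd ℂ) (g s)) 2 M := by
    have hgc' : Continuous fun s => (starRingEnd ℂ) (g s) := Complex.continuous_conj.comp hg
    obtain ⟨C, hC⟩ := isCompact_Icc.exists_bound_of_continuousOn (s := Icc (-b) b)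
      hgc'.continuousOn
    refine MemLp.of_bound hgc'.aestronglyMeasurable C ?_
    exact (ae_restrict_iff' measurableSet_Ioo).2 (ae_of_all _ fun s hs => hC s ⟨hs.1.le, hs.2.le⟩)
  have h1 : Tendsto (fun i => φ i (hgc.toLp _)) U (𝓝 (ψ (hgc.toLp _))) :=
    ((WeakDual.eval_continuous (hgc.toLp _)).tendsto ψ).comp hψ
  have h2 : ∀ u : Lp ℂ 2 M, InnerProductSpace.toDual ℂ _ u (hgc.toLp _)
      = (starRingEnd ℂ) (∫ s in (-b)..b, u s * g s) := by
    intro u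
    rw [InnerProductSpace.toDual_apply_apply, L2.inner_def,
      intervalIntegral.integral_of_le (by linarith), integral_Ioc_eq_integral_Ioo, ← integral_conj]
    refine integral_congr_ae ?_
    filter_upwards [hgc.coeFn_toLp] with s hs
    rw [hs]
    simp [mul_comm]
  have h3 : ∀ i, φ i (hgc.toLp _) = (starRingEnd ℂ) (∫ s in (-b)..b, v i s * g s) := by
    intro i
    refine (h2 ((hv i).toLp (v i))).trans (congrArg _ ?_)
    rw [intervalIntegral.integral_of_le (by linarith), intervalIntegral.integral_of_le (by linarith),
      integral_Ioc_eq_integral_Ioo, integral_Ioc_eq_integral_Ioo]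
    refine integral_congr_ae ?_
    filter_upwards [(hv i).coeFn_toLp] with s hs
    rw [hs]
  have h4 : ψ (hgc.toLp _) = (starRingEnd ℂ) (∫ s in (-b)..b, w s * g s) := by
    rw [← h2 w]
    simp only [w, LinearIsometryEquiv.apply_symm_apply]
    rfl
  simp only [h3, h4] at h1
  simpa [Function.comp_def] using (Complex.continuous_conj.tendsto _).comp h1

theorem encard_le_of_forall_finset {α : Type*} {S : Set α} {o : ℕ∞}
    (h : ∀ T : Finset α, (T : Set α) ⊆ S → (T.card : ℕ∞) ≤ o) : S.encard ≤ o := by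
  by_contra! hlt
  obtain ⟨N, rfl⟩ := ENat.ne_top_iff_exists.1 (ne_top_of_lt hlt)
  obtain ⟨t, hts, ht⟩ := Set.exists_subset_encard_eq (Order.add_one_le_of_lt hlt)
  have hfin : t.Finite := Set.finite_of_encard_eq_coe (k := N + 1) (by exact_mod_cast ht)
  have h1 := h hfin.toFinset (by simpa using hts)
  rw [← Set.encard_coe_eq_coe_finsetCard, hfin.coe_toFinset, ht] at h1
  have h2 : N + 1 ≤ N := by exact_mod_cast h1
  omega

theorem analyticOrderAt_prod_sub {ι : Type*} (s : Finset ι) (μ : ι → ℂ) (z : ℂ) :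
    analyticOrderAt (fun t => ∏ k ∈ s, (t - μ k)) z = ({k ∈ s | μ k = z} : Finset ι).card := by
  classical
  induction s using Finset.induction_on with
  | empty =>
    simp only [Finset.prod_empty, Finset.filter_empty, Finset.card_empty, Nat.cast_zero]
    exact (analyticAt_const.analyticOrderAt_eq_zero).2 one_ne_zero
  | insert k s hk ih =>
    have h1 : AnalyticAt ℂ (fun t => t - μ k) z := by fun_prop
    have h2 : AnalyticAt ℂ (fun t => ∏ k ∈ s, (t - μ k)) z := by fun_prop
    have h3 : (fun t => ∏ k ∈ insert k s, (t - μ k))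
        = (fun t => t - μ k) * fun t => ∏ k ∈ s, (t - μ k) := by
      ext t
      simp [Finset.prod_insert hk]
    rw [h3, analyticOrderAt_mul h1 h2, ih, Finset.filter_insert]
    by_cases hz : μ k = z
    · have h4 : analyticOrderAt (fun t => t - μ k) z = 1 :=
        h1.analyticOrderAt_eq_one_of_zero_deriv_ne_zero (by simp [hz]) (by simp)
      rw [h4, if_pos hz, Finset.card_insert_of_notMem (by simp [hk])]
      push_cast
      ring
    · have h4 : analyticOrderAt (fun t => t - μ k) z = 0 :=
        h1.analyticOrderAt_eq_zero.2 (sub_ne_zero.2 (Ne.symm hz))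
      rw [h4, if_neg hz, zero_add]

/-- Since `(z - ν)/(z - μ) = 1 + (μ - ν)/(z - μ)`, it suffices to divide by `z - μ`, which does not
enlarge the support. -/
theorem exists_ft_replace_zero (hb : 0 ≤ b) (hw : MemLp w 2 (volume.restrict (Ioo (-b) b)))
    {μ : ℂ} (ν : ℂ) (hμ : ft b w μ = 0) :
    ∃ v : ℝ → ℂ, MemLp v 2 (volume.restrict (Ioo (-b) b)) ∧
      ∀ z, ft b v z * (z - μ) = ft b w z * (z - ν) := by
  have hwi := intervalIntegrable_of_memLp hw hb
  obtain ⟨u, hu, h⟩ := exists_ft_eq_sub_mul hb hwi hμ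
  have huL : MemLp u 2 (volume.restrict (Ioo (-b) b)) := by
    obtain ⟨C, hC⟩ := isCompact_Icc.exists_bound_of_continuousOn hu
    refine MemLp.of_bound ((hu.mono Ioo_subset_Icc_self).aestronglyMeasurable measurableSet_Ioo)
      C ?_
    exact (ae_restrict_iff' measurableSet_Ioo).2 (ae_of_all _ fun s hs => hC s ⟨hs.1.le, hs.2.le⟩)
  refine ⟨fun s => w s + (μ - ν) * u s, hw.add (huL.const_mul _), fun z => ?_⟩
  rw [ft_add hwi ((intervalIntegrable_of_memLp huL hb).const_mul _), ft_const_mul, h]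
  ring

variable {μ ν : ℤ → ℂ}

theorem analyticOrderAt_add_card {v : ℝ → ℂ} (hb : 0 ≤ b)
    (hw : MemLp w 2 (volume.restrict (Ioo (-b) b))) (hv : MemLp v 2 (volume.restrict (Ioo (-b) b)))
    {s : Finset ℤ} (h : ∀ z, ft b v z * ∏ k ∈ s, (z - μ k) = ft b w z * ∏ k ∈ s, (z - ν k))
    (z : ℂ) :
    analyticOrderAt (ft b v) z + ({k ∈ s | μ k = z} : Finset ℤ).card
      = analyticOrderAt (ft b w) z + ({k ∈ s | ν k = z} : Finset ℤ).card := by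
  have hwa := analyticAt_ft hb (intervalIntegrable_of_memLp hw hb) z
  have hva := analyticAt_ft hb (intervalIntegrable_of_memLp hv hb) z
  rw [← analyticOrderAt_prod_sub, ← analyticOrderAt_prod_sub,
    ← analyticOrderAt_mul hva (by fun_prop), ← analyticOrderAt_mul hwa (by fun_prop)]
  congr 1
  ext z
  exact h z

theorem card_filter_le_of_encard_le {z : ℂ} {o : ℕ∞} (hμ : {k : ℤ | μ k = z}.encard ≤ o)
    (s : Finset ℤ) : (({k ∈ s | μ k = z} : Finset ℤ).card : ℕ∞) ≤ o := by
  refine le_trans ?_ hμ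
  rw [← Set.encard_coe_eq_coe_finsetCard]
  exact Set.encard_le_encard fun k hk => (Finset.mem_filter.1 hk).2

theorem exists_ft_replace_zeros (hb : 0 ≤ b) (hw : MemLp w 2 (volume.restrict (Ioo (-b) b)))
    (ν : ℤ → ℂ) (hμ : ∀ z, {k : ℤ | μ k = z}.encard ≤ analyticOrderAt (ft b w) z)
    (s : Finset ℤ) :
    ∃ v : ℝ → ℂ, MemLp v 2 (volume.restrict (Ioo (-b) b)) ∧
      ∀ z, ft b v z * ∏ k ∈ s, (z - μ k) = ft b w z * ∏ k ∈ s, (z - ν k) := by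
  classical
  induction s using Finset.induction_on with
  | empty => exact ⟨w, hw, fun z => by simp⟩
  | insert k s hk ih =>
    obtain ⟨v, hv, hvw⟩ := ih
    -- If `μ k` were no longer a zero of `ft b v`, the factors with indices in `s` would already
    -- have used up its whole order in `ft b w`; but that order also has room for the new index `k`.
    have h0 : ft b v (μ k) = 0 := by
      by_contra hne
      have h1 := analyticOrderAt_add_card hb hw hv hvw (μ k)
      rw [(analyticAt_ft hb (intervalIntegrable_of_memLp hv hb) _).analyticOrderAt_eq_zero.2 hne,
        zero_add] at h1
      have h2 := card_filter_le_of_encard_le (hμ (μ k)) (insert k s)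
      rw [Finset.filter_insert, if_pos rfl, Finset.card_insert_of_notMem (by simp [hk])] at h2
      have h3 := h2.trans (le_self_add.trans h1.symm.le)
      have h4 : ∀ n : ℕ, ¬ (((n + 1 : ℕ) : ℕ∞) ≤ n) := fun n h => by
        have : n + 1 ≤ n := by exact_mod_cast h
        omega
      exact h4 _ h3
    obtain ⟨u, hu, huv⟩ := exists_ft_replace_zero hb hv (ν k) h0
    refine ⟨u, hu, fun z => ?_⟩
    rw [Finset.prod_insert hk, Finset.prod_insert hk, ← mul_assoc, huv, mul_right_comm, hvw]
    ring

theorem summable_inv_one_add_abs_sq : Summable fun j : ℤ => (1 / (1 + |(j : ℝ)|)) ^ 2 := by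
  have h : Summable fun j : ℕ => (1 / (1 + (j : ℝ))) ^ 2 := by
    have := (summable_nat_add_iff (f := fun j : ℕ => 1 / (j : ℝ) ^ 2) 1).2
      (Real.summable_one_div_nat_pow.2 one_lt_two)
    refine this.congr fun j => ?_
    push_cast
    rw [div_pow, one_pow, add_comm]
  refine Summable.of_nat_of_neg ?_ ?_ <;> simpa using h

/-- The points of the horizontal line at height `K + 1` are far from a sequence that stays within
distance `K` of the integers. -/
theorem norm_sub_ge_of_norm_sub_int_le {K : ℝ} (hK : 0 ≤ K) {μ : ℂ} {n : ℤ}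
    (h : ‖μ - n‖ ≤ K) (m : ℤ) :
    (1 + |((m - n : ℤ) : ℝ)|) / (K + 2) ≤ ‖(m : ℂ) + (K + 1 : ℝ) * Complex.I - μ‖ := by
  set d := |((m - n : ℤ) : ℝ)| with hd
  have him : 1 ≤ ‖(m : ℂ) + (K + 1 : ℝ) * Complex.I - μ‖ := by
    refine le_trans ?_ ((le_abs_self _).trans (Complex.abs_im_le_norm _))
    have h1 : (μ - n).im ≤ K := (le_abs_self _).trans ((Complex.abs_im_le_norm _).trans h)
    simp at h1 ⊢
    linarith
  have hre : d - K ≤ ‖(m : ℂ) + (K + 1 : ℝ) * Complex.I - μ‖ := by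
    refine le_trans ?_ (Complex.abs_re_le_norm _)
    have h1 : |(μ - n).re| ≤ K := (Complex.abs_re_le_norm _).trans h
    have h2 : ((m : ℂ) + (K + 1 : ℝ) * Complex.I - μ).re = ((m - n : ℤ) : ℝ) - (μ - n).re := by
      simp
    rw [h2]
    linarith [abs_sub_abs_le_abs_sub ((m - n : ℤ) : ℝ) (μ - n).re]
  rw [div_le_iff₀ (by linarith)]
  -- For `d ≤ K + 1` the bound `1` from the imaginary part suffices; beyond that `d - K` from the
  -- real part does. Both agree with the left side at `d = K + 1`.
  rcases le_total d (K + 1) with hle | hle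
  · nlinarith
  · nlinarith

/-- Each factor ratio is at most `1 + |μ_k - ν_k| / |x - μ_k| ≤ exp(|μ_k - ν_k| / |x - μ_k|)`. The
distance from `x` to `μ_k` is comparable to `1 + |m - n_k|`, so AM–GM splits the exponent into two
square-summable pieces; injectivity of `n` bounds the second one. The point is that the constant
depends neither on `s` nor on `m`. -/
theorem prod_norm_sub_le {n : ℤ → ℤ} (hn : Function.Injective n) {K D : ℝ} (hK : 0 ≤ K)
    (hμ : ∀ k, ‖μ k - n k‖ ≤ K) (hD : ∀ s : Finset ℤ, ∑ k ∈ s, ‖μ k - ν k‖ ^ 2 ≤ D)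
    (s : Finset ℤ) (m : ℤ) :
    ∏ k ∈ s, ‖(m : ℂ) + (K + 1 : ℝ) * Complex.I - ν k‖ ≤
      Real.exp ((K + 2) / 2 * (D + ∑' j : ℤ, (1 / (1 + |(j : ℝ)|)) ^ 2)) *
        ∏ k ∈ s, ‖(m : ℂ) + (K + 1 : ℝ) * Complex.I - μ k‖ := by
  set x := (m : ℂ) + (K + 1 : ℝ) * Complex.I
  have hsum : ∑ k ∈ s, (1 / (1 + |((m - n k : ℤ) : ℝ)|)) ^ 2
      ≤ ∑' j : ℤ, (1 / (1 + |(j : ℝ)|)) ^ 2 := by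
    have hinj : Function.Injective fun k => m - n k := fun i j hij => hn (by simpa using hij)
    have h := summable_inv_one_add_abs_sq.sum_le_tsum (s.map ⟨_, hinj⟩) fun j _ => by positivity
    rwa [Finset.sum_map] at h
  have hfac : ∀ k, ‖x - ν k‖ ≤ Real.exp ((K + 2) / 2 *
      (‖μ k - ν k‖ ^ 2 + (1 / (1 + |((m - n k : ℤ) : ℝ)|)) ^ 2)) * ‖x - μ k‖ := by
    intro k
    have h1 := norm_sub_ge_of_norm_sub_int_le hK (hμ k) m
    set e := 1 + |((m - n k : ℤ) : ℝ)| with he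
    have hepos : 0 < e := by positivity
    have hpos : 0 < ‖x - μ k‖ := lt_of_lt_of_le (by positivity) h1
    have h2 : ‖x - ν k‖ ≤ (‖μ k - ν k‖ / ‖x - μ k‖ + 1) * ‖x - μ k‖ := by
      rw [add_mul, one_mul, div_mul_cancel₀ _ hpos.ne', add_comm]
      exact norm_sub_le_norm_sub_add_norm_sub _ _ _
    refine h2.trans (mul_le_mul_of_nonneg_right ((Real.add_one_le_exp _).trans
      (Real.exp_le_exp.2 ?_)) hpos.le)
    calc ‖μ k - ν k‖ / ‖x - μ k‖ ≤ ‖μ k - ν k‖ / (e / (K + 2)) := by gcongr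
      _ = (K + 2) * (‖μ k - ν k‖ * (1 / e)) := by field_simp
      _ ≤ (K + 2) * ((‖μ k - ν k‖ ^ 2 + (1 / e) ^ 2) / 2) := by
        gcongr
        nlinarith [sq_nonneg (‖μ k - ν k‖ - 1 / e)]
      _ = _ := by ring
  calc ∏ k ∈ s, ‖x - ν k‖ ≤ ∏ k ∈ s, (Real.exp ((K + 2) / 2 *
      (‖μ k - ν k‖ ^ 2 + (1 / (1 + |((m - n k : ℤ) : ℝ)|)) ^ 2)) * ‖x - μ k‖) :=
        Finset.prod_le_prod (fun _ _ => norm_nonneg _) fun k _ => hfac k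
    _ = Real.exp ((K + 2) / 2 * (∑ k ∈ s, ‖μ k - ν k‖ ^ 2
          + ∑ k ∈ s, (1 / (1 + |((m - n k : ℤ) : ℝ)|)) ^ 2)) * ∏ k ∈ s, ‖x - μ k‖ := by
        rw [Finset.prod_mul_distrib, ← Real.exp_sum, ← Finset.mul_sum, Finset.sum_add_distrib]
    _ ≤ _ := by
        gcongr
        exact hD s

theorem exists_norm_sub_le_of_summable_sq {n : ℤ → ℤ} (hμ : Summable fun k => ‖μ k - n k‖ ^ 2) :
    ∀ k, ‖μ k - n k‖ ≤ 1 + ∑' k, ‖μ k - n k‖ ^ 2 := by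
  intro k
  have h1 := hμ.le_tsum k fun j _ => by positivity
  nlinarith [sq_nonneg (‖μ k - n k‖ - 1)]

/-- **Stability of incompleteness** under `l₂`-perturbations of the frequencies: if a nonzero
transform vanishes on `μ` (with multiplicities), some nonzero transform vanishes on `ν`. -/
theorem exists_ft_vanishing_of_summable_sq (hb : 0 ≤ b) (hbπ : b ≤ Real.pi)
    {n : ℤ → ℤ} (hn : Function.Injective n)
    (hμn : Summable fun k => ‖μ k - n k‖ ^ 2) (hνn : Summable fun k => ‖ν k - n k‖ ^ 2)
    (hw : MemLp w 2 (volume.restrict (Ioo (-b) b)))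
    (hw0 : ¬ w =ᵐ[volume.restrict (Ioo (-b) b)] 0)
    (hμ : ∀ z, {k : ℤ | μ k = z}.encard ≤ analyticOrderAt (ft b w) z) :
    ∃ v : ℝ → ℂ, MemLp v 2 (volume.restrict (Ioo (-b) b)) ∧
      ¬ v =ᵐ[volume.restrict (Ioo (-b) b)] 0 ∧
      ∀ z, {k : ℤ | ν k = z}.encard ≤ analyticOrderAt (ft b v) z := by
  obtain ⟨K, hK, hμK, hνK⟩ : ∃ K : ℝ, 0 ≤ K ∧ (∀ k, ‖μ k - n k‖ ≤ K) ∧ ∀ k, ‖ν k - n k‖ ≤ K := by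
    refine ⟨max (1 + ∑' k, ‖μ k - n k‖ ^ 2) (1 + ∑' k, ‖ν k - n k‖ ^ 2), ?_, fun k => ?_,
      fun k => ?_⟩
    · exact le_max_of_le_left (by positivity)
    · exact le_max_of_le_left (exists_norm_sub_le_of_summable_sq hμn k)
    · exact le_max_of_le_right (exists_norm_sub_le_of_summable_sq hνn k)
  obtain ⟨D, hD⟩ : ∃ D : ℝ, ∀ s : Finset ℤ, ∑ k ∈ s, ‖μ k - ν k‖ ^ 2 ≤ D := by
    refine ⟨2 * ∑' k, ‖μ k - n k‖ ^ 2 + 2 * ∑' k, ‖ν k - n k‖ ^ 2, fun s => ?_⟩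
    calc ∑ k ∈ s, ‖μ k - ν k‖ ^ 2
        ≤ ∑ k ∈ s, (2 * ‖μ k - n k‖ ^ 2 + 2 * ‖ν k - n k‖ ^ 2) := by
          refine Finset.sum_le_sum fun k _ => ?_
          have h1 : ‖μ k - ν k‖ ≤ ‖μ k - n k‖ + ‖ν k - n k‖ := by
            rw [← norm_neg (ν k - n k), neg_sub]
            exact norm_sub_le_norm_sub_add_norm_sub _ _ _
          nlinarith [norm_nonneg (μ k - ν k), sq_nonneg (‖μ k - n k‖ - ‖ν k - n k‖)]
      _ = 2 * ∑ k ∈ s, ‖μ k - n k‖ ^ 2 + 2 * ∑ k ∈ s, ‖ν k - n k‖ ^ 2 := by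
          rw [Finset.sum_add_distrib, Finset.mul_sum, Finset.mul_sum]
      _ ≤ _ := by
          gcongr
          · exact hμn.sum_le_tsum _ fun k _ => by positivity
          · exact hνn.sum_le_tsum _ fun k _ => by positivity
  set C := Real.exp ((K + 2) / 2 * (D + ∑' j : ℤ, (1 / (1 + |(j : ℝ)|)) ^ 2)) with hC
  have hCpos : 0 < C := Real.exp_pos _
  set x : ℤ → ℂ := fun m => (m : ℂ) + (K + 1 : ℝ) * Complex.I with hx
  -- `v s` has the zeros with indices in `s` moved from `μ` to `ν`. On the integer points of the
  -- line at height `K + 1` its transform stays within the factors `C⁻¹` and `C` of that of `w`.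
  choose v hv hvw using exists_ft_replace_zeros hb hw ν hμ
  have hpos : ∀ {ξ : ℤ → ℂ}, (∀ k, ‖ξ k - n k‖ ≤ K) → ∀ (s : Finset ℤ) (m : ℤ),
      0 < ∏ k ∈ s, ‖x m - ξ k‖ := fun hξ s m => Finset.prod_pos fun k _ =>
    lt_of_lt_of_le (by positivity) (norm_sub_ge_of_norm_sub_int_le hK (hξ k) m)
  have hnorm : ∀ s m, ‖ft b (v s) (x m)‖ * ∏ k ∈ s, ‖x m - μ k‖
      = ‖ft b w (x m)‖ * ∏ k ∈ s, ‖x m - ν k‖ := fun s m => by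
    have := congrArg norm (hvw s (x m))
    simpa only [norm_mul, norm_prod] using this
  have hle : ∀ s m, ‖ft b (v s) (x m)‖ ≤ C * ‖ft b w (x m)‖ := fun s m => by
    refine le_of_mul_le_mul_right ?_ (hpos hμK s m)
    rw [hnorm, mul_comm C, mul_assoc]
    gcongr
    exact prod_norm_sub_le hn hK hμK hD s m
  have hge : ∀ s m, C⁻¹ * ‖ft b w (x m)‖ ≤ ‖ft b (v s) (x m)‖ := fun s m => by
    rw [inv_mul_le_iff₀ hCpos]
    refine le_of_mul_le_mul_right ?_ (hpos hνK s m)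
    rw [← hnorm, mul_comm C, mul_assoc]
    gcongr
    refine prod_norm_sub_le hn hK hνK (fun s => ?_) s m
    simpa only [norm_sub_rev] using hD s
  have hbound : ∀ s, ∫ t in (-b)..b, ‖v s t‖ ^ 2 ≤ Real.exp (|K + 1| * b) ^ 2 / (2 * Real.pi) *
      ∑' m : ℤ, C ^ 2 * ‖ft b w (x m)‖ ^ 2 := fun s => by
    refine (integral_sq_le_tsum_sq_ft hb hbπ (hv s) (K + 1)).trans ?_
    have := Real.pi_pos
    gcongr with m
    · exact (hasSum_sq_ft hb hbπ (hv s) (K + 1)).summable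
    · exact (hasSum_sq_ft hb hbπ hw (K + 1)).summable.mul_left _
    · rw [← mul_pow]
      gcongr
      exact hle s m
  -- The uniform `L₂` bound yields a weak limit `u` as `s` exhausts `ℤ`. Testing against `(it)^i
  -- exp(izt)` turns weak convergence into pointwise convergence of all derivatives of the
  -- transforms.
  obtain ⟨u, hu, U, hU, hlim⟩ := exists_ultrafilter_tendsto_integral (l := atTop) hb hv hbound
  have hderiv : ∀ (i : ℕ) (z : ℂ), Tendsto (fun s => iteratedDeriv i (ft b (v s)) z) U
      (𝓝 (iteratedDeriv i (ft b u) z)) := fun i z => by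
    have h1 : ∀ {f : ℝ → ℂ}, MemLp f 2 (volume.restrict (Ioo (-b) b)) →
        iteratedDeriv i (ft b f) z
          = ∫ t in (-b)..b, f t * ((Complex.I * t) ^ i * Complex.exp (Complex.I * z * t)) := by
      intro f hf
      rw [iteratedDeriv_ft hb (intervalIntegrable_of_memLp hf hb)]
      simp only [ft]
      congr! 2
      ring
    simp only [h1 (hv _), h1 hu]
    exact hlim _ (by fun_prop)
  -- The lower bound by `C⁻¹` passes to the limit: were `u` zero, the transform of `w` would vanish
  -- on the whole line of sampling points, forcing `w = 0`.
  refine ⟨u, hu, fun hu0 => hw0 ?_, fun z => encard_le_of_forall_finset fun T hT => ?_⟩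
  · refine ae_eq_zero_of_ft_eq_zero hb hbπ hw (K + 1) fun m => ?_
    have h1 := (hderiv 0 (x m)).norm
    have h2 : ft b u (x m) = 0 := by
      rw [ft_congr_ae hu0 hb]
      simp [ft]
    simp only [iteratedDeriv_zero, h2, norm_zero] at h1
    have h3 := ge_of_tendsto' h1 fun s => hge s m
    have h4 : ‖ft b w (x m)‖ ≤ 0 := by
      rwa [inv_mul_le_iff₀ hCpos, mul_zero] at h3
    exact norm_le_zero_iff.1 h4
  · rw [natCast_le_analyticOrderAt_iff_iteratedDeriv_eq_zero
      (analyticAt_ft hb (intervalIntegrable_of_memLp hu hb) z)]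
    intro i hi
    -- Once `s ⊇ T`, the order of `ft b (v s)` at `z` is at least `T.card`, so its derivatives of
    -- lower order are eventually zero and so are their limits.
    refine tendsto_nhds_unique (hderiv i z) ((tendsto_congr' ?_).2 tendsto_const_nhds)
    filter_upwards [hU (Ici_mem_atTop T)] with s hs
    refine (natCast_le_analyticOrderAt_iff_iteratedDeriv_eq_zero
      (analyticAt_ft hb (intervalIntegrable_of_memLp (hv s) hb) z)).1 ?_ i hi
    have h1 := analyticOrderAt_add_card hb hw (hv s) (hvw s) z
    have h2 := card_filter_le_of_encard_le (hμ z) s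
    have h3 : T.card ≤ ({k ∈ s | ν k = z} : Finset ℤ).card :=
      Finset.card_le_card fun k hk => Finset.mem_filter.2 ⟨hs hk, hT hk⟩
    have h4 : (({k ∈ s | ν k = z} : Finset ℤ).card : ℕ∞) + ({k ∈ s | μ k = z} : Finset ℤ).card
        ≤ analyticOrderAt (ft b (v s)) z + ({k ∈ s | μ k = z} : Finset ℤ).card := by
      rw [h1, add_comm]
      gcongr
    exact (Nat.cast_le.2 h3).trans
      ((ENat.add_le_add_iff_right (ENat.natCast_ne_top _)).1 h4)

end Transfer

end DelayDirac

namespace DelayDirac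

open Filter Topology

/-! ### The argument principle and Rouché's theorem for entire functions on discs. -/

section Rouche

variable {f g : ℂ → ℂ} {c : ℂ} {R : ℝ}

theorem finite_zeros_closedBall (hf : Differentiable ℂ f) {z₀ : ℂ} (h0 : f z₀ ≠ 0) (c : ℂ) (R : ℝ) :
    {z ∈ Metric.closedBall c R | f z = 0}.Finite := by
  by_contra hinf
  obtain ⟨x, -, hx⟩ := Set.Infinite.exists_accPt_of_subset_isCompact hinf
    (isCompact_closedBall c R) (fun z hz => hz.1)
  rw [accPt_iff_frequently_nhdsNE] at hx
  have h1 : ∃ᶠ y in 𝓝[≠] x, f y = 0 := hx.mono fun y hy => hy.2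
  have h2 := AnalyticOnNhd.eqOn_zero_of_preconnected_of_frequently_eq_zero
    (fun z _ => hf.analyticAt z) isPreconnected_univ (mem_univ x) h1
  exact h0 (h2 (mem_univ z₀))

theorem exists_eq_pow_mul (hf : Differentiable ℂ f) {a : ℂ} {n : ℕ}
    (h : analyticOrderAt f a = n) :
    ∃ g : ℂ → ℂ, Differentiable ℂ g ∧ g a ≠ 0 ∧ ∀ z, f z = (z - a) ^ n * g z := by
  induction n generalizing f with
  | zero =>
    refine ⟨f, hf, ?_, fun z => by simp⟩
    exact (hf.analyticAt a).analyticOrderAt_eq_zero.1 (by exact_mod_cast h)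
  | succ n ih =>
    have h0 : f a = 0 := apply_eq_zero_of_analyticOrderAt_ne_zero (by rw [h]; simp)
    have hd : Differentiable ℂ (dslope f a) := by
      rw [← differentiableOn_univ, Complex.differentiableOn_dslope univ_mem]
      exact hf.differentiableOn
    have heq : ∀ z, f z = (z - a) * dslope f a z := fun z => by
      have := sub_smul_dslope f a z
      rw [h0, sub_zero] at this
      exact this.symm
    have ho : analyticOrderAt (dslope f a) a = n := by
      have h1 : f = (fun z => z - a) * dslope f a := funext heq
      have h2 : analyticOrderAt (fun z : ℂ => z - a) a = 1 :=
        (by fun_prop : AnalyticAt ℂ (fun z : ℂ => z - a) a).analyticOrderAt_eq_one_of_zero_deriv_ne_zero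
          (by simp) (by simp)
      rw [h1, analyticOrderAt_mul (by fun_prop) (hd.analyticAt a), h2, add_comm] at h
      push_cast at h
      refine le_antisymm ((ENat.add_le_add_iff_right ENat.one_ne_top).1 h.le)
        ((ENat.add_le_add_iff_right ENat.one_ne_top).1 h.ge)
    obtain ⟨g, hg, hga, hgf⟩ := ih hd ho
    exact ⟨g, hg, hga, fun z => by rw [heq, hgf]; ring⟩

/-- The points of `Z` are divided out one at a time. The point `z₀` excludes the zero function, so
by the identity theorem all orders are finite. -/
theorem exists_eq_multiset_prod_mul_of_finset (hf : Differentiable ℂ f) {z₀ : ℂ} (h0 : f z₀ ≠ 0)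
    (Z : Finset ℂ) :
    ∃ (M : Multiset ℂ) (g : ℂ → ℂ), (∀ a ∈ M, a ∈ Z) ∧ Differentiable ℂ g ∧
      (∀ z ∈ Z, g z ≠ 0) ∧ ∀ z, f z = (M.map fun a => z - a).prod * g z := by
  classical
  induction Z using Finset.induction_on with
  | empty => exact ⟨0, f, by simp, hf, by simp, by simp⟩
  | insert a Z ha ih =>
    obtain ⟨M, g, hM, hg, hgZ, hfg⟩ := ih
    have htop : analyticOrderAt g a ≠ ⊤ := by
      refine AnalyticOnNhd.analyticOrderAt_ne_top_of_isPreconnected (x := z₀) (U := univ)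
        (fun z _ => hg.analyticAt z) isPreconnected_univ (mem_univ _) (mem_univ _) ?_
      have : g z₀ ≠ 0 := fun h => h0 (by rw [hfg, h, mul_zero])
      rw [(hg.analyticAt z₀).analyticOrderAt_eq_zero.2 this]
      simp
    obtain ⟨n, hn⟩ := ENat.ne_top_iff_exists.1 htop
    obtain ⟨u, hu, hua, hgu⟩ := exists_eq_pow_mul hg hn.symm
    refine ⟨M + Multiset.replicate n a, u, ?_, hu, ?_, fun z => ?_⟩
    · intro y hy
      rcases Multiset.mem_add.1 hy with h | h
      · exact Finset.mem_insert_of_mem (hM y h)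
      · exact Finset.mem_insert.2 (Or.inl (Multiset.eq_of_mem_replicate h))
    · intro z hz
      rcases Finset.mem_insert.1 hz with rfl | h
      · exact hua
      · exact fun h' => hgZ z h (by rw [hgu, h', mul_zero])
    · rw [hfg, hgu, Multiset.map_add, Multiset.prod_add, Multiset.map_replicate,
        Multiset.prod_replicate]
      ring

/-- `M` is the multiset of zeros of `f` in the disc `|z - c| < R`, and `f` has no zeros on the
boundary. -/
def IsZeroMultiset (f : ℂ → ℂ) (c : ℂ) (R : ℝ) (M : Multiset ℂ) : Prop :=
  (∀ a ∈ M, a ∈ Metric.ball c R) ∧ ∃ g : ℂ → ℂ, Differentiable ℂ g ∧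
    (∀ z ∈ Metric.closedBall c R, g z ≠ 0) ∧ ∀ z, f z = (M.map fun a => z - a).prod * g z

theorem exists_isZeroMultiset (hf : Differentiable ℂ f) (hR : 0 ≤ R)
    (hs : ∀ z ∈ Metric.sphere c R, f z ≠ 0) : ∃ M, IsZeroMultiset f c R M := by
  obtain ⟨z₀, hz₀⟩ : (Metric.sphere c R).Nonempty := NormedSpace.sphere_nonempty.2 hR
  have hfin := finite_zeros_closedBall hf (hs z₀ hz₀) c R
  obtain ⟨M, g, hM, hg, hgZ, hfg⟩ :=
    exists_eq_multiset_prod_mul_of_finset hf (hs z₀ hz₀) hfin.toFinset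
  refine ⟨M, fun a ha => ?_, g, hg, fun z hz hgz => ?_, hfg⟩
  · have h1 := hM a ha
    simp only [Finite.mem_toFinset, mem_ofPred_eq] at h1
    by_contra hb
    exact hs a (le_antisymm (Metric.mem_closedBall.1 h1.1) (by simpa using hb)) h1.2
  · exact hgZ z (by simpa using ⟨by simpa using hz, by rw [hfg, hgz, mul_zero]⟩) hgz

theorem differentiable_multiset_prod_sub (M : Multiset ℂ) :
    Differentiable ℂ fun t => (M.map fun a => t - a).prod := by
  induction M using Multiset.induction_on with
  | empty => simp
  | cons a M ih =>
    simp only [Multiset.map_cons, Multiset.prod_cons]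
    exact (differentiable_id.sub_const a).mul ih

theorem differentiableAt_logDeriv (hf : Differentiable ℂ f) {z : ℂ} (hz : f z ≠ 0) :
    DifferentiableAt ℂ (logDeriv f) z :=
  (hf.analyticAt z).deriv.differentiableAt.div (hf z) hz

theorem circleIntegrable_logDeriv (hf : Differentiable ℂ f) (hR : 0 ≤ R)
    (h : ∀ z ∈ Metric.sphere c R, f z ≠ 0) : CircleIntegrable (logDeriv f) c R :=
  ContinuousOn.circleIntegrable hR fun z hz =>
    (differentiableAt_logDeriv hf (h z hz)).continuousAt.continuousWithinAt

theorem IsZeroMultiset.analyticOrderAt_eq {M : Multiset ℂ} (h : IsZeroMultiset f c R M) {z : ℂ}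
    (hz : z ∈ Metric.closedBall c R) : analyticOrderAt f z = M.count z := by
  obtain ⟨hM, g, hg, hgz, hfg⟩ := h
  have key : ∀ M : Multiset ℂ,
      analyticOrderAt (fun t => (M.map fun a => t - a).prod * g t) z = M.count z := by
    intro M
    induction M using Multiset.induction_on with
    | empty => simpa using (hg.analyticAt z).analyticOrderAt_eq_zero.2 (hgz z hz)
    | cons a M ih =>
      have h1 : AnalyticAt ℂ (fun t => t - a) z := by fun_prop
      have h2 : Differentiable ℂ (fun t => (M.map fun a => t - a).prod * g t) := by
        exact (differentiable_multiset_prod_sub M).mul hg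
      have h3 : (fun t => ((a ::ₘ M).map fun a => t - a).prod * g t)
          = (fun t => t - a) * fun t => (M.map fun a => t - a).prod * g t := by
        ext t
        simp [mul_assoc]
      rw [h3, analyticOrderAt_mul h1 (h2.analyticAt z), ih, Multiset.count_cons]
      by_cases hza : z = a
      · have h4 : analyticOrderAt (fun t => t - a) z = 1 :=
          h1.analyticOrderAt_eq_one_of_zero_deriv_ne_zero (by simp [hza]) (by simp)
        rw [h4, if_pos hza]
        push_cast
        ring
      · have h4 : analyticOrderAt (fun t => t - a) z = 0 :=
          h1.analyticOrderAt_eq_zero.2 (sub_ne_zero.2 hza)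
        rw [h4, if_neg hza, zero_add, add_zero]
  rw [← key M]
  congr 1
  ext t
  exact hfg t

/-- The **argument principle** for entire functions on a disc. -/
theorem IsZeroMultiset.circleIntegral_logDeriv (hR : 0 < R) {M : Multiset ℂ}
    (h : IsZeroMultiset f c R M) :
    ∮ z in C(c, R), logDeriv f z = 2 * Real.pi * Complex.I * M.card := by
  obtain ⟨hM, g, hg, hgz, hfg⟩ := h
  rw [show f = fun t => (M.map fun a => t - a).prod * g t from funext hfg]
  clear hfg
  induction M using Multiset.induction_on with
  | empty =>
    simp only [Multiset.map_zero, Multiset.prod_zero, one_mul, Multiset.card_zero, Nat.cast_zero,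
      mul_zero]
    refine Complex.circleIntegral_eq_zero_of_differentiable_on_off_countable hR.le countable_empty
      (fun z hz => ?_) (fun z hz => ?_)
    · exact (differentiableAt_logDeriv hg (hgz z hz)).continuousAt.continuousWithinAt
    · exact differentiableAt_logDeriv hg (hgz z (Metric.ball_subset_closedBall hz.1))
  | cons a M ih =>
    have ha : a ∈ Metric.ball c R := hM a (Multiset.mem_cons_self a M)
    have hM' : ∀ y ∈ M, y ∈ Metric.ball c R := fun y hy => hM y (Multiset.mem_cons_of_mem hy)
    set u : ℂ → ℂ := fun t => (M.map fun a => t - a).prod * g t with hu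
    have hud : Differentiable ℂ u := (differentiable_multiset_prod_sub M).mul hg
    have hsub : ∀ {y z : ℂ}, y ∈ Metric.ball c R → z ∈ Metric.sphere c R → z - y ≠ 0 := by
      intro y z hy hz h0
      rw [sub_eq_zero.1 h0, Metric.mem_sphere] at hz
      exact (Metric.mem_ball.1 hy).ne hz
    have hus : ∀ z ∈ Metric.sphere c R, u z ≠ 0 := by
      intro z hz
      refine mul_ne_zero (Multiset.prod_ne_zero ?_) (hgz z (Metric.sphere_subset_closedBall hz))
      intro h0
      obtain ⟨y, hy, hy0⟩ := Multiset.mem_map.1 h0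
      exact hsub (hM' y hy) hz hy0
    have hcongr : EqOn (logDeriv fun t => ((a ::ₘ M).map fun a => t - a).prod * g t)
        (fun z => (z - a)⁻¹ + logDeriv u z) (Metric.sphere c R) := by
      intro z hz
      have h1 : (fun t => ((a ::ₘ M).map fun a => t - a).prod * g t) = fun t => (t - a) * u t := by
        ext t
        simp [hu, mul_assoc]
      rw [h1, logDeriv_mul (f := fun t => t - a) z (hsub ha hz) (hus z hz) (by fun_prop)
        (hud z)]
      simp [logDeriv_apply]
    rw [circleIntegral.integral_congr hR.le hcongr, circleIntegral.integral_add ?_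
      (circleIntegrable_logDeriv hud hR.le hus), ih hM', circleIntegral.integral_sub_inv_of_mem_ball ha,
      Multiset.card_cons]
    · push_cast
      ring
    · exact ContinuousOn.circleIntegrable hR.le
        (ContinuousOn.inv₀ (by fun_prop) fun z hz => hsub ha hz)

/-- On the circle `|g/f - 1| < 1`, so `g/f` stays in the slit plane and `log(g/f)` is a
single-valued primitive of the difference of the logarithmic derivatives. -/
theorem circleIntegral_logDeriv_eq_of_norm_sub_lt (hf : Differentiable ℂ f)
    (hg : Differentiable ℂ g) (hR : 0 < R)
    (h : ∀ z ∈ Metric.sphere c R, ‖f z - g z‖ < ‖f z‖) :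
    ∮ z in C(c, R), logDeriv f z = ∮ z in C(c, R), logDeriv g z := by
  have hf0 : ∀ z ∈ Metric.sphere c R, f z ≠ 0 := fun z hz h0 => by
    have := h z hz
    rw [h0, norm_zero] at this
    exact this.not_ge (norm_nonneg _)
  have hg0 : ∀ z ∈ Metric.sphere c R, g z ≠ 0 := fun z hz h0 => by
    have := h z hz
    rw [h0, sub_zero] at this
    exact lt_irrefl _ this
  have key : ∮ z in C(c, R), (logDeriv g z - logDeriv f z) = 0 := by
    refine circleIntegral.integral_eq_zero_of_hasDerivWithinAt
      (f := fun z => Complex.log (g z / f z)) hR.le fun z hz => ?_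
    have hslit : g z / f z ∈ Complex.slitPlane := by
      refine Complex.mem_slitPlane_of_norm_lt_one (z := g z / f z - 1) ?_ |> fun h => by simpa using h
      rw [div_sub_one (hf0 z hz), norm_div, div_lt_one (norm_pos_iff.2 (hf0 z hz)), norm_sub_rev]
      exact h z hz
    have h1 := ((hg z).hasDerivAt.div (hf z).hasDerivAt (hf0 z hz)).clog hslit
    refine (h1.congr_deriv ?_).hasDerivWithinAt
    have h2 := hf0 z hz
    have h3 := hg0 z hz
    simp only [logDeriv_apply, Pi.div_apply]
    field_simp
  rw [circleIntegral.integral_sub (circleIntegrable_logDeriv hg hR.le hg0)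
    (circleIntegrable_logDeriv hf hR.le hf0), sub_eq_zero] at key
  exact key.symm

/-- **Rouché's theorem** for entire functions on a disc. -/
theorem card_eq_of_norm_sub_lt (hf : Differentiable ℂ f) (hg : Differentiable ℂ g) (hR : 0 < R)
    (h : ∀ z ∈ Metric.sphere c R, ‖f z - g z‖ < ‖f z‖) {M N : Multiset ℂ}
    (hM : IsZeroMultiset f c R M) (hN : IsZeroMultiset g c R N) : M.card = N.card := by
  have h1 := circleIntegral_logDeriv_eq_of_norm_sub_lt hf hg hR h
  rw [hM.circleIntegral_logDeriv hR, hN.circleIntegral_logDeriv hR] at h1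
  have h2 : (2 * Real.pi * Complex.I : ℂ) ≠ 0 := Complex.two_pi_I_ne_zero
  exact_mod_cast mul_left_cancel₀ h2 h1

end Rouche

end DelayDirac

namespace DelayDirac

open Filter Topology

/-! ### Decay of the transforms near the integers and against `exp(π |Im z|)`. -/

section Decay

variable {b : ℝ} {w : ℝ → ℂ}

theorem summable_sq_ft_int (hb : 0 ≤ b) (hbπ : b ≤ Real.pi)
    (hw : MemLp w 2 (volume.restrict (Ioo (-b) b))) : Summable fun m : ℤ => ‖ft b w m‖ ^ 2 := by
  simpa using (hasSum_sq_ft hb hbπ hw 0).summable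

theorem tendsto_ft_int (hb : 0 ≤ b) (hbπ : b ≤ Real.pi)
    (hw : MemLp w 2 (volume.restrict (Ioo (-b) b))) :
    Tendsto (fun m : ℤ => ‖ft b w m‖) cofinite (𝓝 0) := by
  have h := (summable_sq_ft_int hb hbπ hw).tendsto_cofinite_zero.sqrt
  simpa using h

theorem memLp_pow_mul (hw : MemLp w 2 (volume.restrict (Ioo (-b) b))) (i : ℕ) :
    MemLp (fun s : ℝ => (Complex.I * s) ^ i * w s) 2 (volume.restrict (Ioo (-b) b)) := by
  have hbd : MemLp (fun s : ℝ => (Complex.I * s) ^ i) ⊤ (volume.restrict (Ioo (-b) b)) := by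
    refine memLp_top_of_bound (by fun_prop) (|b| ^ i) ?_
    refine (ae_restrict_iff' measurableSet_Ioo).2 (ae_of_all _ fun s hs => ?_)
    rw [norm_pow, norm_mul, Complex.norm_I, one_mul, Complex.norm_real, Real.norm_eq_abs]
    exact pow_le_pow_left₀ (abs_nonneg s)
      ((abs_le.2 ⟨hs.1.le, hs.2.le⟩).trans (le_abs_self b)) i
  exact hw.mul hbd

theorem norm_ft_pow_mul_int_le (hb : 0 ≤ b) (hw : IntervalIntegrable w volume (-b) b) (i : ℕ)
    (m : ℤ) : ‖ft b (fun s => (Complex.I * s) ^ i * w s) m‖ ≤ b ^ i * ∫ s in (-b)..b, ‖w s‖ := by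
  refine (norm_ft_le hb (IntervalIntegrable.pow_mul hw i) m).trans ?_
  simp only [Complex.intCast_im, abs_zero, mul_zero, Real.exp_zero, one_mul]
  rw [← intervalIntegral.integral_const_mul]
  refine intervalIntegral.integral_mono_on (by linarith) (IntervalIntegrable.pow_mul hw i).norm
    (hw.norm.const_mul _) fun s hs => ?_
  rw [norm_mul, norm_pow, norm_mul, Complex.norm_I, one_mul, Complex.norm_real, Real.norm_eq_abs]
  gcongr
  exact abs_le.2 hs

/-- Uniform **Riemann–Lebesgue lemma** on discs around the integers. -/
theorem eventually_norm_ft_int_add_le (hb : 0 ≤ b) (hbπ : b ≤ Real.pi)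
    (hw : MemLp w 2 (volume.restrict (Ioo (-b) b))) (R : ℝ) {ε : ℝ} (hε : 0 < ε) :
    ∀ᶠ m : ℤ in cofinite, ∀ z : ℂ, ‖z‖ ≤ R → ‖ft b w (m + z)‖ ≤ ε := by
  have hwi := intervalIntegrable_of_memLp hw hb
  rcases lt_or_ge R 0 with hR | hR
  · exact Eventually.of_forall fun m z hz => absurd (hz.trans_lt hR) (norm_nonneg z).not_gt
  -- These are the terms of the Taylor series at `m`, with `|z|` replaced by `R`. Each tends to zero
  -- as `|m| → ∞`, being a Fourier coefficient of `(is)^i w`, and all are dominated by an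
  -- exponential series, so the sum tends to zero.
  set F : ℤ → ℕ → ℝ := fun m i =>
    ((i.factorial : ℝ)⁻¹ * R ^ i) * ‖ft b (fun s => (Complex.I * s) ^ i * w s) m‖ with hF
  have hsummable : Summable fun i : ℕ =>
      ((i.factorial : ℝ)⁻¹ * R ^ i) * (b ^ i * ∫ s in (-b)..b, ‖w s‖) := by
    have h1 := (Real.summable_pow_div_factorial (R * b)).mul_right (∫ s in (-b)..b, ‖w s‖)
    refine h1.congr fun i => ?_
    rw [mul_pow]
    ring
  have hle : ∀ m i, F m i ≤ ((i.factorial : ℝ)⁻¹ * R ^ i) * (b ^ i * ∫ s in (-b)..b, ‖w s‖) := by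
    intro m i
    simp only [hF]
    gcongr
    exact norm_ft_pow_mul_int_le hb hwi i m
  have hF0 : ∀ m i, 0 ≤ F m i := fun m i => by positivity
  have hlim : Tendsto (fun m => ∑' i, F m i) cofinite (𝓝 (∑' _ : ℕ, (0 : ℝ))) := by
    refine tendsto_tsum_of_dominated_convergence hsummable (fun i => ?_)
      (Eventually.of_forall fun m i => ?_)
    · simpa [hF] using (tendsto_ft_int hb hbπ (memLp_pow_mul hw i)).const_mul
        ((i.factorial : ℝ)⁻¹ * R ^ i)
    · rw [Real.norm_of_nonneg (hF0 m i)]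
      exact hle m i
  rw [tsum_zero] at hlim
  filter_upwards [hlim.eventually (gt_mem_nhds hε)] with m hm z hz
  refine le_trans ?_ hm.le
  have ht := Complex.hasSum_taylorSeries_of_entire (differentiable_ft hb hwi) (m : ℂ) (m + z)
  refine ht.norm_le_of_bounded (Summable.of_nonneg_of_le (hF0 m) (hle m) hsummable).hasSum
    fun i => ?_
  rw [iteratedDeriv_ft hb hwi]
  simp only [add_sub_cancel_left, smul_eq_mul, norm_mul, norm_inv, norm_pow, hF]
  rw [← mul_assoc]
  gcongr
  simp

theorem exists_nat_of_eventually_cofinite {P : ℤ → Prop} (h : ∀ᶠ m in cofinite, P m) :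
    ∃ N : ℕ, ∀ m : ℤ, (N : ℤ) < |m| → P m := by
  have hfin : {m | ¬ P m}.Finite := h
  obtain ⟨N, hN⟩ := (hfin.image Int.natAbs).bddAbove
  refine ⟨N, fun m hm => by_contra fun hP => ?_⟩
  have h1 : m.natAbs ≤ N := hN ⟨m, hP, rfl⟩
  rw [Int.abs_eq_natAbs] at hm
  omega

/-- A transform of a function on `(-b, b)` with `b < π` is small compared to `exp(π |Im z|)`. -/
theorem exists_norm_ft_le_exp (hb : 0 ≤ b) (hbπ : b < Real.pi)
    (hw : MemLp w 2 (volume.restrict (Ioo (-b) b))) {ε : ℝ} (hε : 0 < ε) :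
    ∃ ρ : ℝ, ∀ z : ℂ, ρ ≤ ‖z‖ → ‖ft b w z‖ ≤ ε * Real.exp (Real.pi * |z.im|) := by
  have hwi := intervalIntegrable_of_memLp hw hb
  set J := ∫ s in (-b)..b, ‖w s‖ with hJ
  have hJ0 : 0 ≤ J := intervalIntegral.integral_nonneg (by linarith) fun s _ => norm_nonneg _
  -- Above this height the trivial bound `J exp(b |Im z|)` suffices, as `exp((π - b) |Im z|)`
  -- exceeds `J / ε`. In the strip below it, the Riemann–Lebesgue lemma applies around the integer
  -- nearest to `Re z`.
  set Y := J / ε / (Real.pi - b) with hY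
  have hπb : 0 < Real.pi - b := by linarith
  have hY0 : 0 ≤ Y := by positivity
  obtain ⟨N, hN⟩ := exists_nat_of_eventually_cofinite
    (eventually_norm_ft_int_add_le hb hbπ.le hw (1 / 2 + Y) hε)
  refine ⟨N + 1 + (1 / 2 + Y), fun z hz => ?_⟩
  rcases le_total |z.im| Y with him | him
  · set n := round z.re
    have hzn : ‖z - n‖ ≤ 1 / 2 + Y := by
      refine (Complex.norm_le_abs_re_add_abs_im _).trans ?_
      have h1 := abs_sub_round z.re
      simp only [Complex.sub_re, Complex.intCast_re, Complex.sub_im, Complex.intCast_im, sub_zero]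
      linarith
    have hn : (N : ℤ) < |n| := by
      have h1 : ‖z‖ ≤ ‖(n : ℂ)‖ + ‖z - n‖ := norm_le_norm_add_norm_sub' z n |>.trans (by
        rw [norm_sub_rev])
      rw [Complex.norm_intCast] at h1
      have h2 : (N : ℝ) < |(n : ℝ)| := by linarith
      exact_mod_cast h2
    have h3 := hN n hn (z - n) hzn
    rw [add_sub_cancel] at h3
    refine h3.trans (le_mul_of_one_le_right hε.le (Real.one_le_exp (by positivity)))
  · refine (norm_ft_le hb hwi z).trans ?_
    have h1 : J ≤ ε * Real.exp ((Real.pi - b) * |z.im|) := by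
      have h2 : J / ε ≤ (Real.pi - b) * |z.im| := by
        rw [hY, div_le_iff₀ hπb] at him
        linarith
      have h3 := (Real.add_one_le_exp ((Real.pi - b) * |z.im|))
      rw [div_le_iff₀ hε] at h2
      nlinarith
    calc Real.exp (b * |z.im|) * J
        ≤ Real.exp (b * |z.im|) * (ε * Real.exp ((Real.pi - b) * |z.im|)) := by gcongr
      _ = ε * Real.exp (Real.pi * |z.im|) := by
        rw [mul_left_comm, ← Real.exp_add]
        ring_nf

end Decay

/-! ### Lower bounds for `|sin πz|`. -/

section Sine

theorem norm_sin_sq (z : ℂ) :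
    ‖Complex.sin z‖ ^ 2 = Real.sin z.re ^ 2 + Real.sinh z.im ^ 2 := by
  rw [Complex.sin_eq, ← Complex.normSq_eq_norm_sq]
  have h : Complex.sin z.re * Complex.cosh z.im + Complex.cos z.re * Complex.sinh z.im * Complex.I
      = ((Real.sin z.re * Real.cosh z.im : ℝ) : ℂ)
        + ((Real.cos z.re * Real.sinh z.im : ℝ) : ℂ) * Complex.I := by
    push_cast
    rfl
  rw [h, Complex.normSq_add_mul_I]
  nlinarith [Real.sin_sq_add_cos_sq z.re, Real.cosh_sq z.im]

/-- Jordan's inequality bounds the sine of the real part, and `t ≤ sinh t` with `2 ≤ π` handles the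
imaginary part. -/
theorem two_mul_norm_le_norm_sin {z : ℂ} (hz : |z.re| ≤ 1 / 2) :
    2 * ‖z‖ ≤ ‖Complex.sin (Real.pi * z)‖ := by
  have hπ := Real.pi_pos
  refine (sq_le_sq₀ (by positivity) (norm_nonneg _)).1 ?_
  rw [norm_sin_sq, Complex.re_ofReal_mul, Complex.im_ofReal_mul, mul_pow, ← Complex.normSq_eq_norm_sq,
    Complex.normSq_apply]
  have h1 : (2 * |z.re|) ^ 2 ≤ Real.sin (Real.pi * z.re) ^ 2 := by
    have h2 : 2 * |z.re| ≤ Real.sin (Real.pi * |z.re|) := by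
      have h3 := Real.mul_le_sin (x := Real.pi * |z.re|) (by positivity) (by nlinarith)
      have h4 : 2 / Real.pi * (Real.pi * |z.re|) = 2 * |z.re| := by field_simp
      rwa [h4] at h3
    have h5 : Real.sin (Real.pi * |z.re|) ^ 2 = Real.sin (Real.pi * z.re) ^ 2 := by
      rcases abs_cases z.re with ⟨h, -⟩ | ⟨h, -⟩ <;> rw [h]
      rw [mul_neg, Real.sin_neg, neg_sq]
    rw [← h5]
    gcongr
  have h6 : (2 * |z.im|) ^ 2 ≤ Real.sinh (Real.pi * z.im) ^ 2 := by
    rw [← sq_abs (Real.sinh _), Real.abs_sinh, abs_mul, abs_of_pos hπ]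
    have h7 := Real.self_le_sinh_iff.2 (show 0 ≤ Real.pi * |z.im| by positivity)
    have h8 : 2 * |z.im| ≤ Real.pi * |z.im| := by
      gcongr
      exact Real.two_le_pi
    gcongr
    linarith
  rw [mul_pow, sq_abs] at h1 h6
  nlinarith

theorem sin_pi_mul_sub_int (z : ℂ) (n : ℤ) :
    ‖Complex.sin (Real.pi * (z - n))‖ = ‖Complex.sin (Real.pi * z)‖ := by
  refine (sq_eq_sq₀ (norm_nonneg _) (norm_nonneg _)).1 ?_
  simp only [norm_sin_sq, Complex.re_ofReal_mul, Complex.im_ofReal_mul, Complex.sub_re,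
    Complex.sub_im, Complex.intCast_re, Complex.intCast_im, sub_zero]
  rw [mul_sub, mul_comm Real.pi (n : ℝ), Real.sin_sub_int_mul_pi, mul_pow, ← zpow_natCast,
    ← zpow_mul, mul_comm n, zpow_mul]
  simp

/-- For `|Im z| ≤ 1` the left side is at most `1/2`, which is twice the distance `1/4` to the
integers; for larger `|Im z|` the growth of `sinh` is enough. -/
theorem exp_le_norm_sin {z : ℂ} (hz : ∀ n : ℤ, 1 / 4 ≤ ‖z - n‖) :
    Real.exp (-Real.pi) / 2 * Real.exp (Real.pi * |z.im|) ≤ ‖Complex.sin (Real.pi * z)‖ := by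
  have hπ := Real.pi_pos
  rcases le_total |z.im| 1 with him | him
  · set n := round z.re
    have h1 := two_mul_norm_le_norm_sin (z := z - n) (by simpa using abs_sub_round z.re)
    rw [sin_pi_mul_sub_int] at h1
    have h2 : Real.exp (-Real.pi) / 2 * Real.exp (Real.pi * |z.im|) ≤ 1 / 2 := by
      rw [div_mul_eq_mul_div, ← Real.exp_add]
      gcongr
      rw [Real.exp_le_one_iff]
      nlinarith
    linarith [hz n]
  · have h1 : Real.sinh (Real.pi * |z.im|) ≤ ‖Complex.sin (Real.pi * z)‖ := by
      refine le_of_sq_le_sq ?_ (norm_nonneg _)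
      rw [norm_sin_sq, Complex.im_ofReal_mul, ← sq_abs (Real.sinh (Real.pi * z.im)), Real.abs_sinh,
        abs_mul, abs_of_pos hπ]
      nlinarith [sq_nonneg (Real.sin (Real.pi * z : ℂ).re)]
    refine le_trans ?_ h1
    set t := Real.pi * |z.im| with ht
    have ht1 : 1 ≤ t := by nlinarith [Real.two_le_pi]
    have h3 : Real.exp (-Real.pi) ≤ 1 / 2 := by
      have h4 := Real.add_one_le_exp Real.pi
      rw [Real.exp_neg, ← one_div]
      exact one_div_le_one_div_of_le two_pos (by linarith [Real.two_le_pi])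
    have h5 : Real.exp (-t) ≤ 1 / 2 := by
      have h4 := Real.add_one_le_exp t
      rw [Real.exp_neg, ← one_div]
      exact one_div_le_one_div_of_le two_pos (by linarith)
    have h6 := Real.add_one_le_exp t
    rw [Real.sinh_eq]
    nlinarith

end Sine

end DelayDirac

namespace DelayDirac

open Filter Topology

/-! ### Localization of the zeros of `sin πz + ∫ w(s) exp(izs) ds`. -/

section SineTypeZeros

variable {b : ℝ} {w : ℝ → ℂ}

theorem differentiable_sin_pi : Differentiable ℂ fun z : ℂ => Complex.sin (Real.pi * z) := by
  fun_prop

theorem sin_pi_mul_eq_zero_iff {z : ℂ} : Complex.sin (Real.pi * z) = 0 ↔ ∃ k : ℤ, z = k := by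
  rw [Complex.sin_eq_zero_iff]
  have hπ : (Real.pi : ℂ) ≠ 0 := by exact_mod_cast Real.pi_ne_zero
  refine exists_congr fun k => ?_
  rw [mul_comm, mul_left_inj' hπ]

theorem analyticOrderAt_sin_pi_le_one (z : ℂ) :
    analyticOrderAt (fun z : ℂ => Complex.sin (Real.pi * z)) z ≤ 1 := by
  have ha := differentiable_sin_pi.analyticAt z
  by_cases h0 : Complex.sin (Real.pi * z) = 0
  · refine (ha.analyticOrderAt_eq_one_of_zero_deriv_ne_zero h0 ?_).le
    have h1 : HasDerivAt (fun z : ℂ => Complex.sin (Real.pi * z))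
        (Complex.cos (Real.pi * z) * Real.pi) z := by
      simpa using ((hasDerivAt_id z).const_mul (Real.pi : ℂ)).csin
    rw [h1.deriv]
    refine mul_ne_zero (fun hc => ?_) (by exact_mod_cast Real.pi_ne_zero)
    have := Complex.sin_sq_add_cos_sq (Real.pi * z)
    rw [h0, hc] at this
    norm_num at this
  · rw [ha.analyticOrderAt_eq_zero.2 h0]
    exact zero_le_one

theorem IsZeroMultiset.mem_iff {f : ℂ → ℂ} {c : ℂ} {R : ℝ} {M : Multiset ℂ}
    (h : IsZeroMultiset f c R M) {z : ℂ} : z ∈ M ↔ z ∈ Metric.ball c R ∧ f z = 0 := by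
  obtain ⟨hM, g, hg, hgz, hfg⟩ := h
  refine ⟨fun hz => ⟨hM z hz, ?_⟩, fun ⟨hz, h0⟩ => ?_⟩
  · rw [hfg, Multiset.prod_eq_zero (Multiset.mem_map.2 ⟨z, hz, sub_self z⟩), zero_mul]
  · rw [hfg] at h0
    have h1 := (mul_eq_zero.1 h0).resolve_right (hgz z (Metric.ball_subset_closedBall hz))
    obtain ⟨a, ha, haz⟩ := Multiset.mem_map.1 (Multiset.prod_eq_zero_iff.1 h1)
    rwa [sub_eq_zero.1 haz]

theorem card_isZeroMultiset_sin {c : ℂ} {R : ℝ} {M : Multiset ℂ}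
    (h : IsZeroMultiset (fun z => Complex.sin (Real.pi * z)) c R M) {F : Finset ℤ}
    (hF : ∀ k : ℤ, k ∈ F ↔ (k : ℂ) ∈ Metric.ball c R) : M.card = F.card := by
  have hnodup : M.Nodup := by
    rw [Multiset.nodup_iff_count_le_one]
    intro z
    by_cases hz : z ∈ M
    · have h1 := h.analyticOrderAt_eq (Metric.ball_subset_closedBall (h.mem_iff.1 hz).1)
      have h2 := analyticOrderAt_sin_pi_le_one z
      rw [h1] at h2
      exact_mod_cast h2
    · rw [Multiset.count_eq_zero_of_notMem hz]
      exact zero_le_one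
  have hinj : Function.Injective fun k : ℤ => (k : ℂ) := Int.cast_injective
  have : M = (F.val.map fun k : ℤ => (k : ℂ)) := by
    rw [hnodup.ext ((Multiset.nodup_map_iff_of_injective hinj).2 F.nodup)]
    intro z
    rw [h.mem_iff, sin_pi_mul_eq_zero_iff, Multiset.mem_map]
    constructor
    · rintro ⟨hz, k, rfl⟩
      exact ⟨k, (hF k).2 hz, rfl⟩
    · rintro ⟨k, hk, rfl⟩
      exact ⟨(hF k).1 hk, k, rfl⟩
  rw [this, Multiset.card_map]
  rfl

/-- The sine-type function `sin πz + ∫ w(s) exp(izs) ds`. -/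
noncomputable def sineType (b : ℝ) (w : ℝ → ℂ) (z : ℂ) : ℂ := Complex.sin (Real.pi * z) + ft b w z

theorem differentiable_sineType (hb : 0 ≤ b) (hw : IntervalIntegrable w volume (-b) b) :
    Differentiable ℂ (sineType b w) := differentiable_sin_pi.add (differentiable_ft hb hw)

/-- This is the domination needed for Rouché: the transform is `o(exp(π |Im z|))` because `b < π`,
and the constant `exp(-π)/4` is half of the one in the lower bound for the sine. -/
theorem exists_norm_ft_lt_norm_sin (hb : 0 ≤ b) (hbπ : b < Real.pi)
    (hw : MemLp w 2 (volume.restrict (Ioo (-b) b))) :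
    ∃ N₀ : ℕ, ∀ z : ℂ, N₀ ≤ ‖z‖ → (∀ n : ℤ, 1 / 4 ≤ ‖z - n‖) →
      ‖ft b w z‖ < ‖Complex.sin (Real.pi * z)‖ := by
  obtain ⟨ρ, hρ⟩ := exists_norm_ft_le_exp hb hbπ hw (ε := Real.exp (-Real.pi) / 4) (by positivity)
  obtain ⟨N₀, hN₀⟩ := exists_nat_ge ρ
  refine ⟨N₀, fun z hz hzn => ?_⟩
  refine (hρ z (hN₀.trans hz)).trans_lt (lt_of_lt_of_le ?_ (exp_le_norm_sin hzn))
  have h1 : 0 < Real.exp (-Real.pi) := Real.exp_pos _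
  gcongr
  linarith

theorem one_le_norm_int_sub {m n : ℤ} (h : m ≠ n) : (1 : ℝ) ≤ ‖(m : ℂ) - n‖ := by
  rw [← Int.cast_sub, Complex.norm_intCast]
  exact_mod_cast Int.one_le_abs (sub_ne_zero.2 h)

theorem quarter_le_norm_sub_of_mem_sphere {z : ℂ} {n : ℤ} (hz : z ∈ Metric.sphere (n : ℂ) (1 / 4))
    (m : ℤ) : 1 / 4 ≤ ‖z - m‖ := by
  rw [mem_sphere_iff_norm] at hz
  by_cases h : m = n
  · rw [h, hz]
  · have h1 := one_le_norm_int_sub h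
    have h2 : ‖(m : ℂ) - n‖ ≤ ‖z - m‖ + ‖z - n‖ := by
      rw [norm_sub_rev z m]
      exact norm_sub_le_norm_sub_add_norm_sub _ _ _
    linarith

theorem quarter_le_norm_sub_of_norm_eq {z : ℂ} {N : ℕ} (hz : ‖z‖ = N + 1 / 2) (m : ℤ) :
    1 / 4 ≤ ‖z - m‖ := by
  have h1 := abs_norm_sub_norm_le z m
  rw [hz, Complex.norm_intCast] at h1
  refine le_trans ?_ h1
  rcases le_or_gt |m| N with h | h
  · have h2 : |(m : ℝ)| ≤ N := by exact_mod_cast h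
    rw [abs_of_nonneg (by linarith)]
    linarith
  · have h2 : (N : ℝ) + 1 ≤ |(m : ℝ)| := by exact_mod_cast h
    rw [abs_of_nonpos (by linarith)]
    linarith

theorem sineType_ne_zero_of_lt {z : ℂ} (h : ‖ft b w z‖ < ‖Complex.sin (Real.pi * z)‖) :
    sineType b w z ≠ 0 := fun h0 => by
  rw [sineType, add_eq_zero_iff_eq_neg] at h0
  rw [h0, norm_neg] at h
  exact lt_irrefl _ h

/-- By Rouché the count equals that of `sin πz`, whose zeros are simple and sit at the integers. -/
theorem exists_isZeroMultiset_sineType (hb : 0 ≤ b) (hw : IntervalIntegrable w volume (-b) b)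
    {c : ℂ} {R : ℝ} (hR : 0 < R)
    (h : ∀ z ∈ Metric.sphere c R, ‖ft b w z‖ < ‖Complex.sin (Real.pi * z)‖) {F : Finset ℤ}
    (hF : ∀ k : ℤ, k ∈ F ↔ (k : ℂ) ∈ Metric.ball c R) :
    ∃ M, IsZeroMultiset (sineType b w) c R M ∧ M.card = F.card := by
  have hd := differentiable_sineType hb hw
  obtain ⟨M, hM⟩ := exists_isZeroMultiset hd hR.le fun z hz => sineType_ne_zero_of_lt (h z hz)
  obtain ⟨S, hS⟩ := exists_isZeroMultiset differentiable_sin_pi hR.le (c := c) fun z hz h0 => by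
    have := h z hz
    rw [h0, norm_zero] at this
    exact this.not_ge (norm_nonneg _)
  refine ⟨M, hM, ?_⟩
  rw [← card_isZeroMultiset_sin hS hF]
  refine (card_eq_of_norm_sub_lt differentiable_sin_pi hd hR (fun z hz => ?_) hS hM).symm
  rw [sineType, sub_add_cancel_left, norm_neg]
  exact h z hz

/-- Localization of the zeros of `sineType b w`: for large `N`, there are `2N + 1` zeros in the
disc `|z| < N + 1/2`, and the other zeros are simple, one near each integer. -/
theorem exists_zeros_sineType (hb : 0 ≤ b) (hbπ : b < Real.pi)
    (hw : MemLp w 2 (volume.restrict (Ioo (-b) b))) :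
    ∃ N₀ : ℕ, ∀ N : ℕ, N₀ ≤ N →
      (∃ M, IsZeroMultiset (sineType b w) 0 (N + 1 / 2) M ∧
        M.card = (Finset.Icc (-N : ℤ) N).card) ∧
      (∀ n : ℤ, (N : ℤ) < |n| → ∃ a, IsZeroMultiset (sineType b w) n (1 / 4) {a}) ∧
      ∀ z : ℂ, N + 1 / 2 ≤ ‖z‖ → sineType b w z = 0 →
        ∃ n : ℤ, (N : ℤ) < |n| ∧ z ∈ Metric.ball (n : ℂ) (1 / 4) := by
  have hwi := intervalIntegrable_of_memLp hw hb
  obtain ⟨N₀, hN₀⟩ := exists_norm_ft_lt_norm_sin hb hbπ hw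
  refine ⟨N₀, fun N hN => ⟨?_, fun n hn => ?_, fun z hz h0 => ?_⟩⟩
  · have hN' : (N₀ : ℝ) ≤ N := by exact_mod_cast hN
    refine exists_isZeroMultiset_sineType hb hwi (by positivity) (fun z hz => ?_) fun k => ?_
    · rw [mem_sphere_zero_iff_norm] at hz
      exact hN₀ z (by linarith) (quarter_le_norm_sub_of_norm_eq hz)
    · rw [mem_ball_zero_iff, Complex.norm_intCast, Finset.mem_Icc, ← abs_le]
      constructor
      · intro h
        have : |(k : ℝ)| ≤ N := by exact_mod_cast h
        linarith
      · intro h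
        have h1 : |(k : ℝ)| < ((N + 1 : ℤ) : ℝ) := by push_cast; linarith
        have h2 : |k| < N + 1 := by exact_mod_cast h1
        omega
  · have hn' : (N₀ : ℝ) + 1 ≤ ‖(n : ℂ)‖ := by
      rw [Complex.norm_intCast]
      have : (N₀ : ℤ) + 1 ≤ |n| := by omega
      exact_mod_cast this
    have hs : ∀ z ∈ Metric.sphere (n : ℂ) (1 / 4), ‖ft b w z‖ < ‖Complex.sin (Real.pi * z)‖ := by
      intro z hz
      refine hN₀ z ?_ (quarter_le_norm_sub_of_mem_sphere hz)
      rw [mem_sphere_iff_norm] at hz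
      have h1 : ‖(n : ℂ)‖ ≤ ‖z‖ + ‖z - n‖ := norm_le_norm_add_norm_sub _ _
      linarith
    have hF : ∀ k : ℤ, k ∈ ({n} : Finset ℤ) ↔ (k : ℂ) ∈ Metric.ball (n : ℂ) (1 / 4) := by
      intro k
      rw [Finset.mem_singleton, mem_ball_iff_norm]
      constructor
      · rintro rfl
        norm_num
      · intro h
        by_contra hne
        linarith [one_le_norm_int_sub hne]
    obtain ⟨M, hM, hcard⟩ := exists_isZeroMultiset_sineType hb hwi (by norm_num) hs hF
    rw [Finset.card_singleton, Multiset.card_eq_one] at hcard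
    obtain ⟨a, rfl⟩ := hcard
    exact ⟨a, hM⟩
  · by_contra! hcon
    have hN' : (N₀ : ℝ) ≤ N := by exact_mod_cast hN
    refine sineType_ne_zero_of_lt (hN₀ z (by linarith) fun n => ?_) h0
    rcases le_or_gt |n| N with hn | hn
    · have h1 := norm_sub_norm_le z n
      rw [Complex.norm_intCast] at h1
      have h2 : |(n : ℝ)| ≤ N := by exact_mod_cast hn
      linarith
    · have := hcon n hn
      rw [mem_ball_iff_norm, not_lt] at this
      exact this

/-- The distance of a zero near a large integer `n` to `n`. -/
theorem eventually_norm_sub_le_of_sineType_eq_zero (hb : 0 ≤ b) (hbπ : b ≤ Real.pi)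
    (hw : MemLp w 2 (volume.restrict (Ioo (-b) b))) :
    ∀ᶠ n : ℤ in cofinite, ∀ a ∈ Metric.ball (n : ℂ) (1 / 4), sineType b w a = 0 →
      ‖a - n‖ ≤ ‖ft b w n‖ := by
  have hwi := intervalIntegrable_of_memLp hw hb
  have hw1 : MemLp (fun s : ℝ => Complex.I * s * w s) 2 (volume.restrict (Ioo (-b) b)) := by
    simpa using memLp_pow_mul hw 1
  filter_upwards [eventually_norm_ft_int_add_le hb hbπ hw1 (1 / 4) one_pos] with n hn a ha h0
  -- Far out the derivative of the transform is at most `1`, while `2 |a - n| ≤ |sin πa| = |ft b w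
  -- a|`. Absorbing one `|a - n|` leaves the bound by `|ft b w n|`.
  have hmv : ‖ft b w a - ft b w n‖ ≤ 1 * ‖a - n‖ := by
    refine (convex_ball (n : ℂ) (1 / 4)).norm_image_sub_le_of_norm_hasDerivWithin_le
      (fun x _ => (hasDerivAt_ft hb hwi x).hasDerivWithinAt) (fun x hx => ?_)
      (Metric.mem_ball_self (by norm_num)) ha
    have := hn (x - n) (mem_ball_iff_norm.1 hx).le
    rwa [add_sub_cancel] at this
  have h1 : 2 * ‖a - n‖ ≤ ‖Complex.sin (Real.pi * (a - n))‖ := by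
    refine two_mul_norm_le_norm_sin ((Complex.abs_re_le_norm _).trans ?_)
    linarith [mem_ball_iff_norm.1 ha]
  rw [sin_pi_mul_sub_int, eq_neg_of_add_eq_zero_left h0, norm_neg] at h1
  have h2 : ‖ft b w a‖ ≤ ‖ft b w n‖ + ‖ft b w a - ft b w n‖ := norm_le_norm_add_norm_sub' _ _
  linarith

end SineTypeZeros

/-! ### Numbering the zeros of a perturbed function with prescribed values along a subsequence. -/

section Enumeration

variable {b : ℝ} {w w₀ : ℝ → ℂ}

theorem exists_map_eq_of_card_eq {ι α : Type*} [DecidableEq ι] (I : Finset ι) (M : Multiset α)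
    (f : ι → α) (h : M.card = I.card) : ∃ g : ι → α, (∀ i ∉ I, g i = f i) ∧ I.val.map g = M := by
  induction I using Finset.induction_on generalizing M with
  | empty => exact ⟨f, by simp, by simpa [eq_comm] using h⟩
  | insert i I hi ih =>
    rw [Finset.card_insert_of_notMem hi] at h
    obtain ⟨a, ha⟩ := Multiset.card_pos_iff_exists_mem.1 (by omega : 0 < M.card)
    obtain ⟨M', rfl⟩ := Multiset.exists_cons_of_mem ha
    obtain ⟨g, hg, hgM⟩ := ih M' (by simpa using h)
    refine ⟨Function.update g i a, fun j hj => ?_, ?_⟩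
    · rw [Finset.mem_insert, not_or] at hj
      rw [Function.update_of_ne hj.1, hg j hj.2]
    · rw [Finset.insert_val_of_notMem hi, Multiset.map_cons, Function.update_self, ← hgM]
      congr 1
      refine Multiset.map_congr rfl fun j hj => Function.update_of_ne ?_ _ _
      rintro rfl
      exact hi hj

/-- The indices in `A` keep their prescribed values, and the remaining indices receive the rest of
`M` in any order. -/
theorem exists_map_eq_of_map_le {ι α : Type*} [DecidableEq ι] [DecidableEq α] {I A : Finset ι}
    (hA : A ⊆ I) {M : Multiset α} {f : ι → α} (h : M.card = I.card) (hle : A.val.map f ≤ M) :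
    ∃ g : ι → α, (∀ i ∈ A, g i = f i) ∧ I.val.map g = M := by
  obtain ⟨g, hg, hgM⟩ := exists_map_eq_of_card_eq (I \ A) (M - A.val.map f) f (by
    rw [Multiset.card_sub hle, h, Finset.card_sdiff_of_subset hA, Multiset.card_map]
    rfl)
  have hg' : ∀ i ∈ A, g i = f i := fun i hi => hg i (by simp [hi])
  refine ⟨g, hg', ?_⟩
  have hI : I.val = (I \ A).val + A.val := by
    rw [Finset.sdiff_val, Multiset.sub_add_cancel (Finset.val_le_iff.2 hA)]
  rw [hI, Multiset.map_add, hgM, Multiset.map_congr rfl hg', Multiset.sub_add_cancel hle]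

/-- `lam` enumerates the zeros of `sineType b w` with multiplicities, `l₂`-close to the integers. -/
def IsZeroSequence (b : ℝ) (w : ℝ → ℂ) (lam : ℤ → ℂ) : Prop :=
  (∀ z, {n : ℤ | lam n = z}.encard = analyticOrderAt (sineType b w) z) ∧
    Summable fun n : ℤ => ‖lam n - n‖ ^ 2

/-- The values `lam (n k)` are common zeros, with multiplicities, of the old function and of the
added transform, hence zeros of the sum. Outside a large disc each quarter-disc about an integer
holds a single zero, which fixes the numbering; inside, there are as many zeros as indices, and the
prescribed ones can be placed first. -/
theorem exists_isZeroSequence_add (hb : 0 ≤ b) (hbπ : b < Real.pi)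
    (hw : MemLp w 2 (volume.restrict (Ioo (-b) b)))
    (hw₀ : MemLp w₀ 2 (volume.restrict (Ioo (-b) b))) {lam : ℤ → ℂ}
    (hlam : IsZeroSequence b w lam) {n : ℤ → ℤ} (hn : Function.Injective n)
    (h₀ : ∀ z, {k : ℤ | lam (n k) = z}.encard ≤ analyticOrderAt (ft b w₀) z) :
    ∃ lam' : ℤ → ℂ, IsZeroSequence b (fun s => w s + w₀ s) lam' ∧ ∀ k, lam' (n k) = lam (n k) := by
  classical
  have hwi := intervalIntegrable_of_memLp hw hb
  have hw₀i := intervalIntegrable_of_memLp hw₀ hb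
  set w₁ : ℝ → ℂ := fun s => w s + w₀ s with hw₁def
  have hw₁ : MemLp w₁ 2 (volume.restrict (Ioo (-b) b)) := hw.add hw₀
  have hw₁i := intervalIntegrable_of_memLp hw₁ hb
  have hg := differentiable_sineType hb hw₁i
  have hord : ∀ z, {m | m ∈ range n ∧ lam m = z}.encard ≤ analyticOrderAt (sineType b w₁) z := by
    intro z
    have h1 : {m | m ∈ range n ∧ lam m = z} = n '' {k | lam (n k) = z} := by
      ext m
      constructor
      · rintro ⟨⟨k, rfl⟩, h⟩
        exact ⟨k, h, rfl⟩
      · rintro ⟨k, h, rfl⟩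
        exact ⟨⟨k, rfl⟩, h⟩
    have h2 : {m | m ∈ range n ∧ lam m = z}.encard ≤ analyticOrderAt (sineType b w) z := by
      rw [← hlam.1 z]
      exact encard_le_encard fun m hm => hm.2
    have h3 : {m | m ∈ range n ∧ lam m = z}.encard ≤ analyticOrderAt (ft b w₀) z := by
      rw [h1, hn.encard_image]
      exact h₀ z
    have h4 : sineType b w₁ = sineType b w + ft b w₀ := by
      ext t
      simp only [sineType, Pi.add_apply, hw₁def, ft_add hwi hw₀i]
      ring
    rw [h4]
    exact (le_min h2 h3).trans le_analyticOrderAt_add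
  have hzero : ∀ k, sineType b w₁ (lam (n k)) = 0 := by
    intro k
    refine apply_eq_zero_of_analyticOrderAt_ne_zero fun h0 => ?_
    have h1 := hord (lam (n k))
    rw [h0, nonpos_iff_eq_zero, encard_eq_zero] at h1
    exact (eq_empty_iff_forall_notMem.1 h1) (n k) ⟨⟨k, rfl⟩, rfl⟩
  obtain ⟨N₀, hN₀⟩ := exists_zeros_sineType hb hbπ hw₁
  obtain ⟨N₂, hN₂⟩ : ∃ N₂ : ℕ, ∀ m : ℤ, (N₂ : ℤ) < |m| → ‖lam m - m‖ < 1 / 4 := by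
    refine exists_nat_of_eventually_cofinite ?_
    have := hlam.2.tendsto_cofinite_zero.eventually (gt_mem_nhds (show (0 : ℝ) < 1 / 16 by norm_num))
    filter_upwards [this] with m hm
    nlinarith [norm_nonneg (lam m - m)]
  have hK := exists_norm_sub_le_of_summable_sq hlam.2
  set K := 1 + ∑' k, ‖lam k - k‖ ^ 2
  obtain ⟨K', hK'⟩ := exists_nat_ge K
  -- With this `N`, every `lam m` with `|m| ≤ N` lies in the disc of radius `N + 1/2`: for `|m| ≤
  -- N₂` by the global bound `K`, otherwise because `lam m` is within `1/4` of `m`.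
  set N := max N₀ (N₂ + K') with hN
  have hNK : (N₂ : ℝ) + K ≤ N := by
    have : ((N₂ + K' : ℕ) : ℝ) ≤ N := by exact_mod_cast le_max_right _ _
    push_cast at this
    linarith
  obtain ⟨⟨M, hM, hMcard⟩, hsimple, hfar⟩ := hN₀ N (le_max_left _ _)
  choose! a ha using hsimple
  have hlamin : ∀ m : ℤ, |m| ≤ N → lam m ∈ Metric.ball (0 : ℂ) (N + 1 / 2) := by
    intro m hm
    rw [mem_ball_zero_iff]
    have h1 : ‖lam m‖ ≤ |(m : ℝ)| + ‖lam m - m‖ := by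
      rw [← Complex.norm_intCast]
      exact norm_le_norm_add_norm_sub' _ _
    rcases lt_or_ge (N₂ : ℤ) |m| with h | h
    · have h2 : |(m : ℝ)| ≤ N := by exact_mod_cast hm
      linarith [hN₂ m h]
    · have h2 : |(m : ℝ)| ≤ N₂ := by exact_mod_cast h
      linarith [hK m]
  set A := (Finset.Icc (-N : ℤ) N).filter (· ∈ range n) with hA
  have hle : A.val.map lam ≤ M := by
    rw [Multiset.le_iff_count]
    intro z
    by_cases hz : z ∈ Metric.ball (0 : ℂ) (N + 1 / 2)
    · have h1 := hord z
      rw [hM.analyticOrderAt_eq (Metric.ball_subset_closedBall hz)] at h1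
      rw [Multiset.count_map]
      have h2 : ((A.filter fun m => z = lam m).card : ℕ∞) ≤ M.count z := by
        refine le_trans ?_ h1
        rw [← encard_coe_eq_coe_finsetCard]
        refine encard_le_encard fun m hm => ?_
        rw [Finset.mem_coe, Finset.mem_filter, hA, Finset.mem_filter] at hm
        exact ⟨hm.1.2, hm.2.symm⟩
      exact_mod_cast h2
    · rw [Multiset.count_eq_zero_of_notMem]
      · exact Nat.zero_le _
      · intro hmem
        obtain ⟨m, hm, rfl⟩ := Multiset.mem_map.1 hmem
        rw [Finset.mem_val, hA, Finset.mem_filter, Finset.mem_Icc, ← abs_le] at hm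
        exact hz (hlamin m hm.1)
  obtain ⟨g, hgA, hgM⟩ := exists_map_eq_of_map_le (Finset.filter_subset _ _) hMcard hle
  set lam' : ℤ → ℂ := fun m => if (N : ℤ) < |m| then a m else g m with hlam'
  have hout : ∀ m : ℤ, (N : ℤ) < |m| → lam' m = a m := fun m hm => if_pos hm
  have hin : ∀ m : ℤ, |m| ≤ N → lam' m = g m := fun m hm => if_neg hm.not_gt
  have hgmem : ∀ m : ℤ, |m| ≤ N → g m ∈ M := fun m hm => by
    rw [← hgM]
    exact Multiset.mem_map_of_mem g (Finset.mem_def.1 (Finset.mem_Icc.2 (abs_le.1 hm)))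
  have hamem : ∀ m : ℤ, (N : ℤ) < |m| →
      a m ∈ Metric.ball (m : ℂ) (1 / 4) ∧ sineType b w₁ (a m) = 0 :=
    fun m hm => (ha m hm).mem_iff.1 (Multiset.mem_singleton_self _)
  have hanorm : ∀ m : ℤ, (N : ℤ) < |m| → (N : ℝ) + 1 / 2 < ‖a m‖ := fun m hm => by
    have h1 := mem_ball_iff_norm.1 (hamem m hm).1
    have h2 : ‖(m : ℂ)‖ ≤ ‖a m‖ + ‖a m - m‖ := norm_le_norm_add_norm_sub _ _
    have h3 : (N : ℝ) + 1 ≤ |(m : ℝ)| := by exact_mod_cast hm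
    rw [Complex.norm_intCast] at h2
    linarith
  refine ⟨lam', ⟨fun z => ?_, ?_⟩, fun k => ?_⟩
  · by_cases hz : z ∈ Metric.ball (0 : ℂ) (N + 1 / 2)
    · rw [hM.analyticOrderAt_eq (Metric.ball_subset_closedBall hz), ← hgM, Multiset.count_map]
      have h1 : {m | lam' m = z}
          = (((Finset.Icc (-N : ℤ) N).filter fun m => z = g m : Finset ℤ) : Set ℤ) := by
        ext m
        rw [Finset.mem_coe, Finset.mem_filter, Finset.mem_Icc, ← abs_le, mem_ofPred_eq]
        constructor
        · intro hm
          have hmN : |m| ≤ N := by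
            by_contra! hlt
            rw [hout m hlt] at hm
            rw [mem_ball_zero_iff, ← hm] at hz
            exact hz.not_gt (hanorm m hlt)
          exact ⟨hmN, by rw [← hm, hin m hmN]⟩
        · rintro ⟨hmN, rfl⟩
          exact hin m hmN
      rw [h1, encard_coe_eq_coe_finsetCard]
      rfl
    · rw [mem_ball_zero_iff, not_lt] at hz
      have hzin : ∀ m, lam' m = z → (N : ℤ) < |m| := by
        intro m hm
        by_contra! hle
        have h1 := (hM.mem_iff.1 (hgmem m hle)).1
        rw [← hin m hle, hm, mem_ball_zero_iff] at h1
        exact h1.not_ge hz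
      by_cases h0 : sineType b w₁ z = 0
      · obtain ⟨m₀, hm₀, hzm₀⟩ := hfar z hz h0
        have hza : z = a m₀ := Multiset.mem_singleton.1 ((ha m₀ hm₀).mem_iff.2 ⟨hzm₀, h0⟩)
        rw [(ha m₀ hm₀).analyticOrderAt_eq (Metric.ball_subset_closedBall hzm₀), hza,
          Multiset.count_singleton_self]
        have h1 : {m | lam' m = a m₀} = {m₀} := by
          ext m
          rw [mem_ofPred_eq, mem_singleton_iff, ← hza]
          constructor
          · intro hm
            have hmN := hzin m hm
            rw [hout m hmN] at hm
            by_contra hne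
            have h2 := mem_ball_iff_norm.1 (hamem m hmN).1
            have h3 := mem_ball_iff_norm.1 hzm₀
            rw [hm, norm_sub_rev] at h2
            have h4 := norm_sub_le_norm_sub_add_norm_sub (m : ℂ) z m₀
            linarith [one_le_norm_int_sub hne]
          · rintro rfl
            rw [hout m hm₀, hza]
        rw [h1, encard_singleton]
        rfl
      · rw [(hg.analyticAt z).analyticOrderAt_eq_zero.2 h0, encard_eq_zero,
          eq_empty_iff_forall_notMem]
        intro m hm
        have hmN := hzin m hm
        rw [mem_ofPred_eq, hout m hmN] at hm
        exact h0 (hm ▸ (hamem m hmN).2)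
  -- For large `|m|` the deviation of the zero from `m` is at most `|ft b w₁ m|`, which is
  -- square-summable by Parseval.
  · refine (summable_sq_ft_int hb hbπ.le hw₁).of_norm_bounded_eventually ?_
    have hfin : ∀ᶠ m : ℤ in cofinite, (N : ℤ) < |m| := by
      refine (Finset.finite_toSet (Finset.Icc (-N : ℤ) N)).subset fun m hm => ?_
      rw [mem_compl_iff, mem_ofPred_eq, not_lt, abs_le] at hm
      exact Finset.mem_coe.2 (Finset.mem_Icc.2 hm)
    filter_upwards [hfin, eventually_norm_sub_le_of_sineType_eq_zero hb hbπ.le hw₁] with m hm h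
    rw [Real.norm_of_nonneg (by positivity), hout m hm]
    have := h (a m) (hamem m hm).1 (hamem m hm).2
    gcongr
  · rcases lt_or_ge (N : ℤ) |n k| with h | h
    · rw [hout _ h]
      refine (Multiset.mem_singleton.1 ((ha _ h).mem_iff.2 ⟨mem_ball_iff_norm.2 (hN₂ _ ?_),
        hzero k⟩)).symm
      have : N₂ ≤ N := (Nat.le_add_right _ _).trans (le_max_right _ _)
      omega
    · rw [hin _ h]
      exact hgA _ (Finset.mem_filter.2 ⟨Finset.mem_Icc.2 (abs_le.1 h), ⟨k, rfl⟩⟩)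

end Enumeration

end DelayDirac

namespace DelayDirac

open Filter Topology

/-! ### The scalar linear equation `f' = c f - h`. -/

section LinearODE

/-- The integrating factor `exp(-ct)` turns the equation into `(exp(-ct) f)' = -exp(-ct) h`, which
is integrated from `0`. -/
theorem eq_exp_mul_of_ae_hasDerivAt {f h : ℝ → ℂ} {c : ℂ} {L : ℝ}
    (hf : AbsolutelyContinuousOnInterval f 0 L) (hh : IntervalIntegrable h volume 0 L)
    (hd : ∀ᵐ x ∂(volume.restrict (Ioo 0 L)), HasDerivAt f (c * f x - h x) x) :
    ∀ x ∈ Icc 0 L, f x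
      = Complex.exp (c * x) * (f 0 - ∫ t in (0 : ℝ)..x, Complex.exp (-c * t) * h t) := by
  intro x hx
  have hxL : uIcc 0 x ⊆ uIcc 0 L := uIcc_subset_uIcc left_mem_uIcc (by
    rw [uIcc_of_le (hx.1.trans hx.2)]; exact hx)
  have he : ∀ t : ℝ, HasDerivAt (fun t : ℝ => Complex.exp (-c * t))
      (-c * Complex.exp (-c * t)) t := by
    intro t
    have h1 : HasDerivAt (fun t : ℝ => -c * (t : ℂ)) (-c) t := by
      simpa using (Complex.ofRealCLM.hasDerivAt (x := t)).const_mul (-c)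
    exact h1.cexp.congr_deriv (by ring)
  have heAC : AbsolutelyContinuousOnInterval (fun t : ℝ => Complex.exp (-c * t)) 0 x :=
    ContDiffOn.absolutelyContinuousOnInterval
      (contDiff_const.mul Complex.ofRealCLM.contDiff).cexp.contDiffOn
  have hi : IntervalIntegrable (fun t : ℝ => -(Complex.exp (-c * t) * h t)) volume 0 x :=
    ((hh.mono_set hxL).continuousOn_mul (by fun_prop)).neg
  have key := (heAC.smul (hf.mono hxL)).integral_eq_sub hi (by
    have h0 : ∀ᵐ t : ℝ, t ≠ 0 := by simp [ae_iff, measure_singleton]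
    have hL : ∀ᵐ t : ℝ, t ≠ L := by simp [ae_iff, measure_singleton]
    filter_upwards [(ae_restrict_iff' measurableSet_Ioo).1 hd, h0, hL] with t ht ht0 htL htm
    rw [uIcc_of_le hx.1] at htm
    have htI : t ∈ Ioo 0 L :=
      ⟨lt_of_le_of_ne htm.1 (Ne.symm ht0), lt_of_le_of_ne (htm.2.trans hx.2) htL⟩
    refine ((he t).smul (ht htI)).congr_deriv ?_
    simp only [smul_eq_mul]
    ring)
  rw [intervalIntegral.integral_neg] at key
  simp only [Pi.smul_apply', smul_eq_mul, Complex.ofReal_zero, mul_zero, Complex.exp_zero,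
    one_mul] at key
  have h2 : Complex.exp (-c * x) * f x
      = f 0 - ∫ t in (0 : ℝ)..x, Complex.exp (-c * t) * h t := by
    linear_combination -key
  rw [← h2, ← mul_assoc, ← Complex.exp_add]
  simp

end LinearODE

/-! ### Explicit solutions and characteristic functions of the delayed system. -/

section Potential

variable {a : ℝ} {p q : ℝ → ℂ}

theorem IsPotential.add (hp : IsPotential a p) (hq : IsPotential a q) :
    IsPotential a (fun x => p x + q x) := by
  refine ⟨hp.1.add hq.1, ?_⟩
  filter_upwards [hp.2, hq.2] with x h1 h2
  rw [h1, h2, add_zero]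

theorem IsPotential.const_mul (hp : IsPotential a p) (c : ℂ) :
    IsPotential a (fun x => c * p x) := by
  refine ⟨hp.1.const_mul c, ?_⟩
  filter_upwards [hp.2] with x h1
  rw [h1, mul_zero]

theorem IsPotential.intervalIntegrable (hp : IsPotential a p) :
    IntervalIntegrable p volume 0 Real.pi := by
  rw [intervalIntegrable_iff_integrableOn_Ioo_of_le Real.pi_pos.le]
  exact hp.1.integrable one_le_two

theorem IsPotential.integral_mul_eq_zero (hp : IsPotential a p) (g : ℝ → ℂ) {x : ℝ} (hx : 0 ≤ x)
    (hxa : x ≤ a) : ∫ t in (0 : ℝ)..x, p t * g t = 0 := by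
  rw [intervalIntegral.integral_of_le hx, integral_Ioc_eq_integral_Ioo]
  refine integral_eq_zero_of_ae ?_
  have h1 : ∀ᵐ t ∂(volume.restrict (Ioo 0 x)), p t = 0 :=
    ae_restrict_of_ae_restrict_of_subset (Ioo_subset_Ioo_right hxa) hp.2
  filter_upwards [h1] with t ht
  simp [ht]

/-- The component `y₂ + i y₁` of the solution with `y(0) = (0, 1)`, for the potential
`u = p + i q`. -/
noncomputable def component (a : ℝ) (u : ℝ → ℂ) (lam : ℂ) (x : ℝ) : ℂ :=
  Complex.exp (-Complex.I * lam * x) *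
    (1 - ∫ t in (0 : ℝ)..x, u t * Complex.exp (Complex.I * lam * (2 * t - a)))

variable {u v : ℝ → ℂ}

theorem component_eq_exp (hu : IsPotential a u) (lam : ℂ) {x : ℝ} (hx : 0 ≤ x) (hxa : x ≤ a) :
    component a u lam x = Complex.exp (-Complex.I * lam * x) := by
  rw [component, hu.integral_mul_eq_zero _ hx hxa, sub_zero, mul_one]

theorem absolutelyContinuous_component (hu : IsPotential a u) (lam : ℂ) :
    AbsolutelyContinuousOnInterval (component a u lam) 0 Real.pi := by
  have h1 : AbsolutelyContinuousOnInterval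
      (fun t : ℝ => Complex.exp (-Complex.I * lam * t)) 0 Real.pi :=
    ContDiffOn.absolutelyContinuousOnInterval
      (contDiff_const.mul Complex.ofRealCLM.contDiff).cexp.contDiffOn
  have h2 : IntervalIntegrable
      (fun t : ℝ => u t * Complex.exp (Complex.I * lam * (2 * t - a))) volume 0 Real.pi :=
    hu.intervalIntegrable.mul_continuousOn (by fun_prop)
  have h3 : AbsolutelyContinuousOnInterval (fun _ : ℝ => (1 : ℂ)) 0 Real.pi :=
    ContDiffOn.absolutelyContinuousOnInterval contDiff_const.contDiffOn
  exact h1.smul (h3.sub (absolutelyContinuousOnInterval_primitive h2 left_mem_uIcc))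

theorem ae_hasDerivAt_component (hu : IsPotential a u) (lam : ℂ) :
    ∀ᵐ x ∂(volume.restrict (Ioo 0 Real.pi)), HasDerivAt (component a u lam)
      (-Complex.I * lam * component a u lam x - u x * Complex.exp (Complex.I * lam * (x - a))) x := by
  have h2 : IntervalIntegrable
      (fun t : ℝ => u t * Complex.exp (Complex.I * lam * (2 * t - a))) volume 0 Real.pi :=
    hu.intervalIntegrable.mul_continuousOn (by fun_prop)
  rw [ae_restrict_iff' measurableSet_Ioo]
  filter_upwards [h2.ae_hasDerivAt_integral] with x hx hxI
  have h3 := hx (by rw [uIcc_of_le Real.pi_pos.le]; exact ⟨hxI.1.le, hxI.2.le⟩) 0 left_mem_uIcc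
  have h1 : HasDerivAt (fun t : ℝ => Complex.exp (-Complex.I * lam * t))
      (-Complex.I * lam * Complex.exp (-Complex.I * lam * x)) x := by
    have h1 : HasDerivAt (fun t : ℝ => -Complex.I * lam * (t : ℂ)) (-Complex.I * lam) x := by
      simpa using (Complex.ofRealCLM.hasDerivAt (x := x)).const_mul (-Complex.I * lam)
    exact h1.cexp.congr_deriv (by ring)
  refine (h1.mul (h3.const_sub 1)).congr_deriv ?_
  have h4 : Complex.exp (Complex.I * lam * (x - a)) = Complex.exp (-Complex.I * lam * x) *
      Complex.exp (Complex.I * lam * (2 * x - a)) := by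
    rw [← Complex.exp_add]
    congr 1
    ring
  rw [h4, component]
  ring

/-- Here `a ≥ π/2` enters: for `a < x < π` the argument `x - a` lies in `[0, a]`, and for `x < a`
the factor `u x` vanishes. So the delayed term only sees values on `[0, a]`. -/
theorem ae_mul_eq_of_eqOn (ha : Real.pi / 2 ≤ a) (hu : IsPotential a u) {f g : ℝ → ℂ}
    (h : ∀ x ∈ Icc 0 a, f x = g x) :
    ∀ᵐ x ∂(volume.restrict (Ioo 0 Real.pi)), u x * f (x - a) = u x * g (x - a) := by
  have h1 := (ae_restrict_iff' measurableSet_Ioo).1 hu.2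
  have h2 : ∀ᵐ x : ℝ, x ≠ a := by simp [ae_iff, measure_singleton]
  rw [ae_restrict_iff' measurableSet_Ioo]
  filter_upwards [h1, h2] with x hx hxa hxI
  rcases lt_or_gt_of_ne hxa with hlt | hgt
  · rw [hx ⟨hxI.1, hlt⟩, zero_mul, zero_mul]
  · rw [h (x - a) ⟨by linarith, by linarith [hxI.2]⟩]

/-- The characteristic functions, in terms of `y₂ ± i y₁`. -/
noncomputable def charFun (a : ℝ) (p q : ℝ → ℂ) (j : Fin 2) (lam : ℂ) : ℂ :=
  ![(component a (fun x => p x + Complex.I * q x) lam Real.pi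
      - component a (fun x => p x - Complex.I * q x) (-lam) Real.pi) / (2 * Complex.I),
    (component a (fun x => p x + Complex.I * q x) lam Real.pi
      + component a (fun x => p x - Complex.I * q x) (-lam) Real.pi) / 2] j

theorem IsPotential.add_I_mul (hp : IsPotential a p) (hq : IsPotential a q) :
    IsPotential a (fun x => p x + Complex.I * q x) := hp.add (hq.const_mul _)

theorem IsPotential.sub_I_mul (hp : IsPotential a p) (hq : IsPotential a q) :
    IsPotential a (fun x => p x - Complex.I * q x) := by
  simpa [sub_eq_add_neg] using hp.add (hq.const_mul (-Complex.I))

theorem absolutelyContinuous_pi_of_components {y : ℝ → Fin 2 → ℂ} {L : ℝ}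
    (h : ∀ i, AbsolutelyContinuousOnInterval (fun x => y x i) 0 L) :
    AbsolutelyContinuousOnInterval y 0 L := by
  have key : ∀ i, AbsolutelyContinuousOnInterval (fun x => Pi.single i (y x i)
      : ℝ → Fin 2 → ℂ) 0 L := fun i => (h i).of_dist_le fun x _ x' _ => by
    rw [dist_eq_norm, ← Pi.single_sub, Pi.norm_single, dist_eq_norm]
  have hy : y = (fun x => Pi.single 0 (y x 0)) + fun x => Pi.single 1 (y x 1) := by
    ext x i
    fin_cases i <;> simp
  rw [hy]
  exact (key 0).add (key 1)

theorem exists_isSolution (ha : Real.pi / 2 ≤ a) (hp : IsPotential a p) (hq : IsPotential a q)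
    (lam : ℂ) : ∃ y : ℝ → Fin 2 → ℂ, IsSolution a p q lam y ∧ y 0 = ![0, 1] ∧
      ∀ j, y Real.pi j = charFun a p q j lam := by
  set u : ℝ → ℂ := fun x => p x + Complex.I * q x with hu_def
  set v : ℝ → ℂ := fun x => p x - Complex.I * q x with hv_def
  have hu : IsPotential a u := hp.add_I_mul hq
  have hv : IsPotential a v := hp.sub_I_mul hq
  set Z := component a u lam with hZ
  set W := component a v (-lam) with hW
  have hI : Complex.I ≠ 0 := Complex.I_ne_zero
  refine ⟨fun x => ![(Z x - W x) / (2 * Complex.I), (Z x + W x) / 2], ⟨?_, ?_⟩, ?_, ?_⟩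
  · have hZAC := absolutelyContinuous_component hu lam
    have hWAC := absolutelyContinuous_component hv (-lam)
    refine absolutelyContinuous_pi_of_components fun i => ?_
    fin_cases i
    · refine ((hZAC.sub hWAC).const_smul (2 * Complex.I)⁻¹).of_dist_le fun x _ y _ => le_of_eq ?_
      simp [hZ, hW, div_eq_inv_mul]
    · refine ((hZAC.add hWAC).const_smul (2 : ℂ)⁻¹).of_dist_le fun x _ y _ => le_of_eq ?_
      simp [hZ, hW, div_eq_inv_mul]
  · have e1 := ae_mul_eq_of_eqOn ha hu (f := W)
      (g := fun x => Complex.exp (Complex.I * lam * x)) fun x hx => by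
        rw [hW, component_eq_exp hv _ hx.1 hx.2]
        congr 1
        ring
    have e2 := ae_mul_eq_of_eqOn ha hv (f := Z)
      (g := fun x => Complex.exp (Complex.I * (-lam) * x)) fun x hx => by
        rw [hZ, component_eq_exp hu _ hx.1 hx.2]
        congr 1
        ring
    filter_upwards [e1, e2, ae_hasDerivAt_component hu lam, ae_hasDerivAt_component hv (-lam)]
      with x h1 h2 h3 h4
    rw [← hZ] at h3
    rw [← hW] at h4
    push_cast at h1 h2
    rw [← h1] at h3
    rw [← h2] at h4
    refine ⟨![((-Complex.I * lam * Z x - u x * W (x - a))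
        - (-Complex.I * (-lam) * W x - v x * Z (x - a))) / (2 * Complex.I),
      ((-Complex.I * lam * Z x - u x * W (x - a))
        + (-Complex.I * (-lam) * W x - v x * Z (x - a))) / 2], ?_, ?_⟩
    · rw [hasDerivAt_pi]
      intro i
      fin_cases i
      · exact (h3.sub h4).div_const _
      · exact (h3.add h4).div_const _
    · ext i
      fin_cases i
      · simp [B, Q, hu_def, hv_def]
        field_simp
        ring_nf
        simp
        ring
      · simp [B, Q, hu_def, hv_def]
        field_simp
        ring
  · ext i
    fin_cases i <;> simp [hZ, hW, component]
  · intro j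
    fin_cases j <;> rfl

theorem eq_mul_exp_of_ae_hasDerivAt (ha : Real.pi / 2 ≤ a) (haπ : a < Real.pi)
    (hu : IsPotential a u) {lam s : ℂ} {f g : ℝ → ℂ}
    (hf : AbsolutelyContinuousOnInterval f 0 Real.pi) (h0 : f 0 = s)
    (hd : ∀ᵐ x ∂(volume.restrict (Ioo 0 Real.pi)),
      HasDerivAt f (-Complex.I * lam * f x - u x * g (x - a)) x) :
    ∀ x ∈ Icc 0 a, f x = s * Complex.exp (-Complex.I * lam * x) := by
  have ha0 : 0 ≤ a := by linarith [Real.pi_pos]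
  have hd' : ∀ᵐ x ∂(volume.restrict (Ioo 0 a)), HasDerivAt f (-Complex.I * lam * f x - 0) x := by
    have := ae_restrict_of_ae_restrict_of_subset (Ioo_subset_Ioo_right haπ.le) hd
    filter_upwards [this, hu.2] with x hx hux
    simpa [hux] using hx
  intro x hx
  have hsub : uIcc 0 a ⊆ uIcc 0 Real.pi := by
    rw [uIcc_of_le ha0, uIcc_of_le Real.pi_pos.le]
    exact Icc_subset_Icc_right haπ.le
  have := eq_exp_mul_of_ae_hasDerivAt (h := fun _ => 0) (hf.mono hsub)
    intervalIntegrable_const hd' x hx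
  rw [this, h0]
  simp [mul_comm]

theorem eq_mul_component_of_ae_hasDerivAt (ha : Real.pi / 2 ≤ a)
    (hu : IsPotential a u) {lam s : ℂ} {f g : ℝ → ℂ}
    (hf : AbsolutelyContinuousOnInterval f 0 Real.pi) (h0 : f 0 = s)
    (hd : ∀ᵐ x ∂(volume.restrict (Ioo 0 Real.pi)),
      HasDerivAt f (-Complex.I * lam * f x - u x * g (x - a)) x)
    (hg : ∀ x ∈ Icc 0 a, g x = s * Complex.exp (Complex.I * lam * x)) :
    ∀ x ∈ Icc 0 Real.pi, f x = s * component a u lam x := by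
  have h1 := ae_mul_eq_of_eqOn ha hu (f := g)
    (g := fun x => s * Complex.exp (Complex.I * lam * x)) hg
  have hi : IntervalIntegrable
      (fun x : ℝ => u x * (s * Complex.exp (Complex.I * lam * ((x - a : ℝ) : ℂ)))) volume 0 Real.pi :=
    hu.intervalIntegrable.mul_continuousOn (by fun_prop)
  intro x hx
  have key := eq_exp_mul_of_ae_hasDerivAt hf hi (by
    filter_upwards [h1, hd] with x hx hdx
    rwa [hx] at hdx) x hx
  rw [key, h0, component, mul_left_comm, mul_sub s, mul_one, ← intervalIntegral.integral_const_mul]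
  congr 3
  ext t
  have : Complex.exp (Complex.I * lam * (2 * t - a)) = Complex.exp (-(-Complex.I * lam) * t) *
      Complex.exp (Complex.I * lam * ((t - a : ℝ) : ℂ)) := by
    rw [← Complex.exp_add]
    congr 1
    push_cast
    ring
  rw [this]
  ring

/-- Passing to `y₂ ± i y₁` diagonalizes the constant part and couples the two functions only through
the delay. Both start from `y₂(0)`, are exponentials on `[0, a]`, and feeding these into each
other's delayed term determines them on `[0, π]`. -/
theorem IsSolution.eq_mul_component (ha : Real.pi / 2 ≤ a) (haπ : a < Real.pi)
    (hp : IsPotential a p) (hq : IsPotential a q) {lam : ℂ} {y : ℝ → Fin 2 → ℂ}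
    (hy : IsSolution a p q lam y) (h0 : y 0 0 = 0) : ∀ x ∈ Icc 0 Real.pi,
      y x 1 + Complex.I * y x 0 = y 0 1 * component a (fun x => p x + Complex.I * q x) lam x ∧
      y x 1 - Complex.I * y x 0 = y 0 1 * component a (fun x => p x - Complex.I * q x) (-lam) x := by
  have hu := hp.add_I_mul hq
  have hv := hp.sub_I_mul hq
  have hc : ∀ i, AbsolutelyContinuousOnInterval (fun x => y x i) 0 Real.pi := fun i =>
    hy.1.of_dist_le fun x _ x' _ => dist_le_pi_dist (y x) (y x') i
  have hI := Complex.I_sq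
  have hd : ∀ᵐ x ∂(volume.restrict (Ioo 0 Real.pi)),
      HasDerivAt (fun x => y x 1 + Complex.I * y x 0)
        (-Complex.I * lam * (y x 1 + Complex.I * y x 0)
          - (p x + Complex.I * q x) * (y (x - a) 1 - Complex.I * y (x - a) 0)) x ∧
      HasDerivAt (fun x => y x 1 - Complex.I * y x 0)
        (-Complex.I * (-lam) * (y x 1 - Complex.I * y x 0)
          - (p x - Complex.I * q x) * (y (x - a) 1 + Complex.I * y (x - a) 0)) x := by
    filter_upwards [hy.2] with x hx
    obtain ⟨y', hy', heq⟩ := hx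
    rw [hasDerivAt_pi] at hy'
    have e0 := congrFun heq 0
    have e1 := congrFun heq 1
    simp [B, Q, Matrix.vecHead, Matrix.vecTail] at e0 e1
    constructor
    · refine ((hy' 1).add ((hy' 0).const_mul Complex.I)).congr_deriv ?_
      linear_combination e0 - Complex.I * e1
        + (lam * y x 0 - q x * y (x - a) 0) * hI
    · refine ((hy' 1).sub ((hy' 0).const_mul Complex.I)).congr_deriv ?_
      linear_combination e0 + Complex.I * e1
        + (lam * y x 0 - q x * y (x - a) 0) * hI
  have hZAC : AbsolutelyContinuousOnInterval (fun x => y x 1 + Complex.I * y x 0) 0 Real.pi :=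
    (hc 1).add ((hc 0).const_smul Complex.I)
  have hWAC : AbsolutelyContinuousOnInterval (fun x => y x 1 - Complex.I * y x 0) 0 Real.pi :=
    (hc 1).sub ((hc 0).const_smul Complex.I)
  have hZ := eq_mul_exp_of_ae_hasDerivAt ha haπ hu (s := y 0 1) hZAC (by simp [h0])
    (g := fun x => y x 1 - Complex.I * y x 0) (hd.mono fun x hx => hx.1)
  have hW := eq_mul_exp_of_ae_hasDerivAt ha haπ hv (s := y 0 1) hWAC (by simp [h0])
    (g := fun x => y x 1 + Complex.I * y x 0) (hd.mono fun x hx => hx.2)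
  intro x hx
  constructor
  · refine eq_mul_component_of_ae_hasDerivAt ha hu (s := y 0 1) hZAC (by simp [h0])
      (g := fun x => y x 1 - Complex.I * y x 0) (hd.mono fun x hx => hx.1) (fun t ht => ?_) x hx
    rw [hW t ht]
    congr 2
    ring
  · refine eq_mul_component_of_ae_hasDerivAt ha hv (s := y 0 1) hWAC (by simp [h0])
      (g := fun x => y x 1 + Complex.I * y x 0) (hd.mono fun x hx => hx.2) (fun t ht => ?_) x hx
    rw [hZ t ht]
    congr 2
    ring

theorem IsSolution.apply_pi (ha : Real.pi / 2 ≤ a) (haπ : a < Real.pi)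
    (hp : IsPotential a p) (hq : IsPotential a q) {lam : ℂ} {y : ℝ → Fin 2 → ℂ}
    (hy : IsSolution a p q lam y) (h0 : y 0 0 = 0) (j : Fin 2) :
    y Real.pi j = y 0 1 * charFun a p q j lam := by
  obtain ⟨h1, h2⟩ := hy.eq_mul_component ha haπ hp hq h0 Real.pi ⟨Real.pi_pos.le, le_rfl⟩
  have hI : Complex.I ≠ 0 := Complex.I_ne_zero
  fin_cases j
  · simp only [charFun, Fin.zero_eta, Matrix.cons_val_zero]
    rw [mul_div_assoc', mul_sub, ← h1, ← h2]
    field_simp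
    ring
  · simp only [charFun, Fin.mk_one, Matrix.cons_val_one, Matrix.cons_val_fin_one]
    rw [mul_div_assoc', mul_add, ← h1, ← h2]
    ring

theorem isCharFun_iff (ha : Real.pi / 2 ≤ a) (haπ : a < Real.pi)
    (hp : IsPotential a p) (hq : IsPotential a q) {j : Fin 2} {Δ : ℂ → ℂ} :
    IsCharFun a p q j Δ ↔ Δ = charFun a p q j := by
  constructor
  · intro h
    ext lam
    obtain ⟨y, hy, hy0, hΔ⟩ := h lam
    rw [hΔ, hy.apply_pi ha haπ hp hq (by simp [hy0])]
    simp [hy0]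
  · rintro rfl lam
    obtain ⟨y, hy, hy0, hyπ⟩ := exists_isSolution ha hp hq lam
    exact ⟨y, hy, hy0, (hyπ j).symm⟩

theorem isEigenvalue_iff (ha : Real.pi / 2 ≤ a) (haπ : a < Real.pi)
    (hp : IsPotential a p) (hq : IsPotential a q) {j : Fin 2} {lam : ℂ} :
    IsEigenvalue a p q j lam ↔ charFun a p q j lam = 0 := by
  constructor
  · rintro ⟨y, hy, ⟨x, hx, hyx⟩, h0, hπ⟩
    rw [hy.apply_pi ha haπ hp hq h0] at hπ
    -- If `y₂(0)` vanished too, both combinations `y₂ ± i y₁`, and with them `y`, would vanish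
    -- identically.
    refine (mul_eq_zero.1 hπ).resolve_left fun hs => hyx ?_
    obtain ⟨h1, h2⟩ := hy.eq_mul_component ha haπ hp hq h0 x hx
    rw [hs, zero_mul] at h1 h2
    have h3 : y x 1 = 0 := by linear_combination (h1 + h2) / 2
    have h4 : Complex.I * y x 0 = 0 := by linear_combination (h1 - h2) / 2
    ext i
    fin_cases i
    · exact (mul_eq_zero.1 h4).resolve_left Complex.I_ne_zero
    · exact h3
  · intro h
    obtain ⟨y, hy, hy0, hyπ⟩ := exists_isSolution ha hp hq lam
    refine ⟨y, hy, ⟨0, ⟨le_rfl, Real.pi_pos.le⟩, fun h => ?_⟩, by simp [hy0], by rw [hyπ, h]⟩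
    have := congrFun (hy0.symm.trans h) 1
    simp at this

end Potential

end DelayDirac

namespace DelayDirac

open Filter Topology

/-! ### Affine changes of variable in `L₂` and in almost-everywhere statements. -/

section Affine

theorem map_mul_add_restrict {c d : ℝ} (hc : c ≠ 0) (S : Set ℝ) :
    (volume.restrict ((fun t => c * t + d) ⁻¹' S)).map (fun t => c * t + d)
      = ENNReal.ofReal |c⁻¹| • volume.restrict S := by
  have he : MeasurableEmbedding fun t : ℝ => c * t + d :=
    (measurableEmbedding_addRight d).comp (measurableEmbedding_mulLeft₀ hc)
  rw [← he.restrict_map, show (fun t : ℝ => c * t + d) = (fun t => t + d) ∘ fun t => c * t from rfl,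
    ← Measure.map_map (measurable_add_const d) (measurable_const_mul c),
    Real.map_volume_mul_left hc, Measure.map_smul, map_add_right_eq_self, Measure.restrict_smul]

theorem memLp_comp_mul_add {c d : ℝ} (hc : c ≠ 0) {S T : Set ℝ} (hST : ∀ t, t ∈ T ↔ c * t + d ∈ S)
    {f : ℝ → ℂ} (hf : MemLp f 2 (volume.restrict S)) :
    MemLp (fun t => f (c * t + d)) 2 (volume.restrict T) := by
  have hT : T = (fun t => c * t + d) ⁻¹' S := Set.ext hST
  have he : MeasurableEmbedding fun t : ℝ => c * t + d :=
    (measurableEmbedding_addRight d).comp (measurableEmbedding_mulLeft₀ hc)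
  have h1 : MemLp f 2 ((volume.restrict T).map fun t => c * t + d) := by
    rw [hT, map_mul_add_restrict hc]
    exact hf.smul_measure ENNReal.ofReal_ne_top
  exact (he.memLp_map_measure_iff).1 h1

theorem ae_comp_mul_add {c d : ℝ} (hc : c ≠ 0) {S T : Set ℝ} (hST : ∀ t, t ∈ T ↔ c * t + d ∈ S)
    {P : ℝ → Prop} (h : ∀ᵐ s ∂(volume.restrict S), P s) :
    ∀ᵐ t ∂(volume.restrict T), P (c * t + d) := by
  have hT : T = (fun t => c * t + d) ⁻¹' S := Set.ext hST
  have he : MeasurableEmbedding fun t : ℝ => c * t + d :=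
    (measurableEmbedding_addRight d).comp (measurableEmbedding_mulLeft₀ hc)
  rw [← he.ae_map_iff, hT, map_mul_add_restrict hc]
  exact Measure.ae_smul_measure h _

end Affine

/-! ### The linear correspondence between potentials and the functions in the characteristic
functions. -/

section Core

variable {a : ℝ} {p q u : ℝ → ℂ}

theorem mem_Ioo_iff_half_mul_add (a s : ℝ) :
    s ∈ Ioo (-(Real.pi - a)) (Real.pi - a) ↔ 1 / 2 * s + (Real.pi + a) / 2 ∈ Ioo a Real.pi := by
  simp only [mem_Ioo]
  constructor <;> rintro ⟨h1, h2⟩ <;> constructor <;> linarith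

theorem mem_Ioo_iff_neg_half_mul_add (a s : ℝ) :
    s ∈ Ioo (-(Real.pi - a)) (Real.pi - a) ↔ -(1 / 2) * s + (Real.pi + a) / 2 ∈ Ioo a Real.pi := by
  simp only [mem_Ioo]
  constructor <;> rintro ⟨h1, h2⟩ <;> constructor <;> linarith

/-- The functions `w` for which, up to sign and a shift, the characteristic functions are
`sin πz + ∫ w(s) exp(izs) ds`. -/
noncomputable def core (a : ℝ) (p q : ℝ → ℂ) : Fin 2 → ℝ → ℂ :=
  ![fun s => -(Complex.I / 2) *
      ((p (1 / 2 * s + (Real.pi + a) / 2) + Complex.I * q (1 / 2 * s + (Real.pi + a) / 2)) / 2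
        - (p (-(1 / 2) * s + (Real.pi + a) / 2)
          - Complex.I * q (-(1 / 2) * s + (Real.pi + a) / 2)) / 2),
    fun s => -(1 / 2) *
      ((p (1 / 2 * s + (Real.pi + a) / 2) + Complex.I * q (1 / 2 * s + (Real.pi + a) / 2)) / 2
        + (p (-(1 / 2) * s + (Real.pi + a) / 2)
          - Complex.I * q (-(1 / 2) * s + (Real.pi + a) / 2)) / 2)
      * Complex.exp (Complex.I * (-1 / 2) * s)]

theorem IsPotential.memLp_Ioo (ha : 0 ≤ a) (hu : IsPotential a u) :
    MemLp u 2 (volume.restrict (Ioo a Real.pi)) :=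
  hu.1.mono_measure (Measure.restrict_mono (Ioo_subset_Ioo_left ha) le_rfl)

theorem IsPotential.memLp_half (ha : 0 ≤ a) (hu : IsPotential a u) :
    MemLp (fun s => u (1 / 2 * s + (Real.pi + a) / 2) / 2) 2
      (volume.restrict (Ioo (-(Real.pi - a)) (Real.pi - a))) := by
  simp only [div_eq_inv_mul (u _)]
  exact (memLp_comp_mul_add (by norm_num) (mem_Ioo_iff_half_mul_add a) (hu.memLp_Ioo ha)).const_mul _

theorem IsPotential.memLp_neg_half (ha : 0 ≤ a) (hu : IsPotential a u) :
    MemLp (fun s => u (-(1 / 2) * s + (Real.pi + a) / 2) / 2) 2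
      (volume.restrict (Ioo (-(Real.pi - a)) (Real.pi - a))) := by
  simp only [div_eq_inv_mul (u _)]
  exact (memLp_comp_mul_add (by norm_num) (mem_Ioo_iff_neg_half_mul_add a)
    (hu.memLp_Ioo ha)).const_mul _

theorem memLp_mul_exp {b : ℝ} {w : ℝ → ℂ} (hw : MemLp w 2 (volume.restrict (Ioo (-b) b))) (c : ℝ) :
    MemLp (fun s : ℝ => w s * Complex.exp (Complex.I * c * s)) 2
      (volume.restrict (Ioo (-b) b)) := by
  have hbd : MemLp (fun s : ℝ => Complex.exp (Complex.I * c * s)) ⊤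
      (volume.restrict (Ioo (-b) b)) := by
    refine memLp_top_of_bound (by fun_prop) 1 (ae_of_all _ fun s => ?_)
    rw [Complex.norm_exp]
    simp
  exact hbd.mul hw

theorem memLp_core (ha : 0 ≤ a) (hp : IsPotential a p) (hq : IsPotential a q) (j : Fin 2) :
    MemLp (core a p q j) 2 (volume.restrict (Ioo (-(Real.pi - a)) (Real.pi - a))) := by
  have hU := (hp.add_I_mul hq).memLp_half ha
  have hV := (hp.sub_I_mul hq).memLp_neg_half ha
  fin_cases j
  · exact (hU.sub hV).const_mul _
  · have := memLp_mul_exp ((hU.add hV).const_mul (-(1 / 2))) (-1 / 2)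
    push_cast at this
    exact this

theorem ft_neg (b : ℝ) (w : ℝ → ℂ) (z : ℂ) : ft b w (-z) = ft b (fun s => w (-s)) z := by
  rw [ft, ft, ← neg_neg b, ← intervalIntegral.integral_comp_neg]
  simp

/-- The substitution `s = 2t - π - a` maps `(a, π)` onto `(a - π, π - a)` and merges the two
exponentials into `exp(iλs)`; its Jacobian is the factor `1/2`. -/
theorem component_pi (ha : 0 ≤ a) (haπ : a < Real.pi) (hu : IsPotential a u) (lam : ℂ) :
    component a u lam Real.pi = Complex.exp (-Complex.I * lam * Real.pi)
      - ft (Real.pi - a) (fun s => u (1 / 2 * s + (Real.pi + a) / 2) / 2) lam := by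
  have hi : IntervalIntegrable
      (fun t : ℝ => u t * Complex.exp (Complex.I * lam * (2 * t - a))) volume 0 Real.pi :=
    hu.intervalIntegrable.mul_continuousOn (by fun_prop)
  have hmem : a ∈ uIcc 0 Real.pi := by
    rw [uIcc_of_le Real.pi_pos.le]
    exact ⟨ha, haπ.le⟩
  rw [component, ← intervalIntegral.integral_add_adjacent_intervals
    (hi.mono_set (uIcc_subset_uIcc left_mem_uIcc hmem))
    (hi.mono_set (uIcc_subset_uIcc hmem right_mem_uIcc)),
    hu.integral_mul_eq_zero _ ha le_rfl, zero_add, mul_sub, mul_one, ft]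
  congr 1
  have key := intervalIntegral.integral_comp_mul_add (a := -(Real.pi - a)) (b := Real.pi - a)
    (fun t : ℝ => u t * Complex.exp (Complex.I * lam * (2 * t - a)))
    (show (1 / 2 : ℝ) ≠ 0 by norm_num) ((Real.pi + a) / 2)
  rw [show 1 / 2 * -(Real.pi - a) + (Real.pi + a) / 2 = a by ring,
    show 1 / 2 * (Real.pi - a) + (Real.pi + a) / 2 = Real.pi by ring] at key
  have h2 : ∫ t in a..Real.pi, u t * Complex.exp (Complex.I * lam * (2 * t - a))
      = (1 / 2 : ℂ) * ∫ s in (-(Real.pi - a))..(Real.pi - a),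
        u (1 / 2 * s + (Real.pi + a) / 2) * Complex.exp (Complex.I * lam *
          (2 * ((1 / 2 * s + (Real.pi + a) / 2 : ℝ) : ℂ) - a)) := by
    rw [key, Complex.real_smul]
    push_cast
    ring
  rw [h2, ← mul_assoc, ← intervalIntegral.integral_const_mul]
  congr 1
  ext s
  have : Complex.exp (Complex.I * lam * s) = Complex.exp (-Complex.I * lam * Real.pi) *
      Complex.exp (Complex.I * lam * (2 * ((1 / 2 * s + (Real.pi + a) / 2 : ℝ) : ℂ) - a)) := by
    rw [← Complex.exp_add]
    congr 1
    push_cast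
    ring
  rw [this]
  ring

/-- For `j = 1` the leading term `cos πλ` is written as `sin π(λ + 1/2)`; the factor `exp(-is/2)` in
`core` compensates this shift inside the transform. -/
theorem charFun_eq_sineType (ha : 0 ≤ a) (haπ : a < Real.pi) (hp : IsPotential a p)
    (hq : IsPotential a q) (j : Fin 2) (lam : ℂ) :
    charFun a p q j lam =
      (![-1, 1] : Fin 2 → ℂ) j * sineType (Real.pi - a) (core a p q j) (lam + (j : ℕ) / 2) := by
  have hb : 0 ≤ Real.pi - a := by linarith
  have hU := intervalIntegrable_of_memLp ((hp.add_I_mul hq).memLp_half ha) hb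
  have hV := intervalIntegrable_of_memLp ((hp.sub_I_mul hq).memLp_neg_half ha) hb
  have h1 := component_pi ha haπ (hp.add_I_mul hq) lam
  have h2 := component_pi ha haπ (hp.sub_I_mul hq) (-lam)
  rw [ft_neg] at h2
  simp only [mul_neg, ← neg_mul] at h2
  rw [show -Complex.I * lam * Real.pi = -(Real.pi * lam) * Complex.I by ring] at h1
  rw [show - -Complex.I * lam * Real.pi = Real.pi * lam * Complex.I by ring] at h2
  have hI := Complex.I_sq
  have hI0 := Complex.I_ne_zero
  fin_cases j
  · have h3 : ft (Real.pi - a) (core a p q 0) lam = _ := (ft_const_mul _ _).trans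
      (congrArg _ (ft_sub hU hV lam))
    simp only [charFun, Fin.zero_eta, Matrix.cons_val_zero, sineType, Nat.cast_zero, zero_div,
      add_zero]
    rw [h3, h1, h2, Complex.sin]
    field_simp
    rw [hI]
    ring
  · have h3 : ft (Real.pi - a) (core a p q 1) (lam + 1 / 2) = _ := (ft_mul_exp _ _).trans
      ((ft_const_mul _ _).trans (congrArg _ (ft_add hU hV _)))
    rw [show lam + 1 / 2 + -1 / 2 = lam by ring] at h3
    simp only [charFun, Fin.mk_one, Matrix.cons_val_one, Matrix.cons_val_fin_one, sineType,
      Nat.cast_one]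
    rw [h3, h1, h2, mul_add (Real.pi : ℂ), mul_one_div, Complex.sin_add_pi_div_two, Complex.cos]
    ring

theorem analyticOrderAt_charFun (ha : 0 ≤ a) (haπ : a < Real.pi) (hp : IsPotential a p)
    (hq : IsPotential a q) (j : Fin 2) (z : ℂ) :
    analyticOrderAt (charFun a p q j) z
      = analyticOrderAt (sineType (Real.pi - a) (core a p q j)) (z + (j : ℕ) / 2) := by
  have hb : 0 ≤ Real.pi - a := by linarith
  have hd := differentiable_sineType hb (intervalIntegrable_of_memLp (memLp_core ha hp hq j) hb)
  have h1 : charFun a p q j = (fun _ => (![-1, 1] : Fin 2 → ℂ) j) *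
      (sineType (Real.pi - a) (core a p q j) ∘ fun lam => lam + (j : ℕ) / 2) :=
    funext fun lam => charFun_eq_sineType ha haπ hp hq j lam
  have h2 : AnalyticAt ℂ (fun lam : ℂ => lam + (j : ℕ) / 2) z := by fun_prop
  have h3 : analyticOrderAt (fun _ : ℂ => (![-1, 1] : Fin 2 → ℂ) j) z = 0 :=
    analyticAt_const.analyticOrderAt_eq_zero.2 (by fin_cases j <;> simp)
  rw [h1, analyticOrderAt_mul analyticAt_const
    ((hd.analyticAt (z + (j : ℕ) / 2)).comp_of_eq h2 rfl), h3, zero_add,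
    analyticOrderAt_comp_of_deriv_ne_zero h2 (by simp)]

/-- The eigenvalue clause of `IsSpectrum` is implied by the multiplicity clause, since a point is an
eigenvalue exactly when the order there is nonzero. -/
theorem isSpectrum_iff (ha : Real.pi / 2 ≤ a) (haπ : a < Real.pi) (hp : IsPotential a p)
    (hq : IsPotential a q) {j : Fin 2} {lam : ℤ → ℂ} :
    IsSpectrum a p q j lam ↔
      IsZeroSequence (Real.pi - a) (core a p q j) fun n => lam n + (j : ℕ) / 2 := by
  have ha0 : 0 ≤ a := by linarith [Real.pi_pos]
  have hord : (∀ z, {n : ℤ | lam n = z}.encard = analyticOrderAt (charFun a p q j) z) ↔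
      ∀ z, {n : ℤ | lam n + (j : ℕ) / 2 = z}.encard
        = analyticOrderAt (sineType (Real.pi - a) (core a p q j)) z := by
    constructor
    · intro h z
      have := h (z - (j : ℕ) / 2)
      rw [analyticOrderAt_charFun ha0 haπ hp hq, sub_add_cancel] at this
      simpa only [eq_sub_iff_add_eq] using this
    · intro h z
      have := h (z + (j : ℕ) / 2)
      rw [analyticOrderAt_charFun ha0 haπ hp hq]
      simpa only [add_left_inj] using this
  have hl2 : Memℓp (fun n : ℤ => lam n - ((n : ℂ) - ((j : ℕ) : ℂ) / 2)) 2 ↔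
      Summable fun n : ℤ => ‖lam n + (j : ℕ) / 2 - n‖ ^ 2 := by
    rw [memℓp_gen_iff (by norm_num)]
    refine summable_congr fun n => ?_
    rw [show lam n - ((n : ℂ) - ((j : ℕ) : ℂ) / 2) = lam n + (j : ℕ) / 2 - n by ring]
    norm_num
  constructor
  · rintro ⟨-, ⟨Δ, hΔ, h⟩, h2⟩
    rw [isCharFun_iff ha haπ hp hq] at hΔ
    subst hΔ
    exact ⟨hord.1 h, hl2.1 h2⟩
  · rintro ⟨h, h2⟩
    have h' := hord.2 h
    refine ⟨fun z => ?_, ⟨_, (isCharFun_iff ha haπ hp hq).2 rfl, h'⟩, hl2.2 h2⟩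
    rw [isEigenvalue_iff ha haπ hp hq]
    have h3 : AnalyticAt ℂ (charFun a p q j) z := by
      have hb : 0 ≤ Real.pi - a := by linarith
      have hd := differentiable_sineType hb
        (intervalIntegrable_of_memLp (memLp_core ha0 hp hq j) hb)
      rw [funext fun lam => charFun_eq_sineType ha0 haπ hp hq j lam]
      exact ((hd.comp (differentiable_id.add_const _)).const_mul _).analyticAt z
    rw [← h3.analyticOrderAt_ne_zero, ← h', Ne, encard_eq_zero, ← Ne, ← nonempty_iff_ne_empty]
    rfl

theorem isPotential_indicator (ha : 0 ≤ a) {f : ℝ → ℂ}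
    (hf : MemLp f 2 (volume.restrict (Ioo a Real.pi))) :
    IsPotential a ((Ioo a Real.pi).indicator f) := by
  constructor
  · rw [memLp_indicator_iff_restrict measurableSet_Ioo,
      Measure.restrict_restrict_of_subset (Ioo_subset_Ioo_left ha)]
    exact hf
  · refine (ae_restrict_iff' measurableSet_Ioo).2 (ae_of_all _ fun x hx => ?_)
    exact indicator_of_notMem (fun h => h.1.not_gt hx.2) f

/-- Any pair of functions of `L₂(-(π - a), π - a)` comes from a pair of potentials. -/
theorem exists_isPotential_core_eq (ha : 0 ≤ a) {w : Fin 2 → ℝ → ℂ}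
    (hw : ∀ j, MemLp (w j) 2 (volume.restrict (Ioo (-(Real.pi - a)) (Real.pi - a)))) :
    ∃ p q : ℝ → ℂ, IsPotential a p ∧ IsPotential a q ∧
      ∀ j, ∀ s ∈ Ioo (-(Real.pi - a)) (Real.pi - a), core a p q j s = w j s := by
  set η : ℝ → ℂ := fun s => w 1 s * Complex.exp (Complex.I * (1 / 2 : ℝ) * s) with hη
  have hηL : MemLp η 2 (volume.restrict (Ioo (-(Real.pi - a)) (Real.pi - a))) :=
    memLp_mul_exp (hw 1) (1 / 2)
  -- `U` and `V` solve `-(i/2)(U - V) = w 0` and `-(1/2)(U + V) = η`, where `η` is `w 1` freed of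
  -- the factor `exp(-is/2)`. They are the halves of `p + iq` and `p - iq` in the variable `s`,
  -- which gives `p = u + v` and `q = -i(u - v)`.
  set U : ℝ → ℂ := fun s => Complex.I * w 0 s - η s with hU
  set V : ℝ → ℂ := fun s => -Complex.I * w 0 s - η s with hV
  have hUL : MemLp U 2 (volume.restrict (Ioo (-(Real.pi - a)) (Real.pi - a))) :=
    ((hw 0).const_mul _).sub hηL
  have hVL : MemLp V 2 (volume.restrict (Ioo (-(Real.pi - a)) (Real.pi - a))) :=
    ((hw 0).const_mul _).sub hηL
  have hu : MemLp (fun t => U (2 * t + -(Real.pi + a))) 2 (volume.restrict (Ioo a Real.pi)) :=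
    memLp_comp_mul_add two_ne_zero (fun t => by
      simp only [mem_Ioo]; constructor <;> rintro ⟨h1, h2⟩ <;> constructor <;> linarith) hUL
  have hv : MemLp (fun t => V (-2 * t + (Real.pi + a))) 2 (volume.restrict (Ioo a Real.pi)) :=
    memLp_comp_mul_add (by norm_num) (fun t => by
      simp only [mem_Ioo]; constructor <;> rintro ⟨h1, h2⟩ <;> constructor <;> linarith) hVL
  refine ⟨_, _, isPotential_indicator ha (hu.add hv),
    isPotential_indicator ha ((hu.sub hv).const_mul (-Complex.I)), fun j s hs => ?_⟩
  have h1 := (mem_Ioo_iff_half_mul_add a s).1 hs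
  have h2 := (mem_Ioo_iff_neg_half_mul_add a s).1 hs
  have e1 : 2 * (1 / 2 * s + (Real.pi + a) / 2) + -(Real.pi + a) = s := by ring
  have e2 : -2 * (-(1 / 2) * s + (Real.pi + a) / 2) + (Real.pi + a) = s := by ring
  have hI := Complex.I_sq
  have hexp : Complex.exp (Complex.I * (1 / 2 : ℝ) * s) * Complex.exp (Complex.I * (-1 / 2) * s)
      = 1 := by
    rw [← Complex.exp_add, Complex.exp_eq_one_iff]
    refine ⟨0, ?_⟩
    push_cast
    ring
  have kU : ∀ u v : ℂ, (u + v + Complex.I * (-Complex.I * (u - v))) / 2 = u := fun u v => by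
    linear_combination (-(u - v) / 2) * hI
  have kV : ∀ u v : ℂ, (u + v - Complex.I * (-Complex.I * (u - v))) / 2 = v := fun u v => by
    linear_combination ((u - v) / 2) * hI
  fin_cases j
  · simp only [core, Fin.zero_eta, Matrix.cons_val_zero, indicator_of_mem h1, indicator_of_mem h2,
      Pi.add_apply, Pi.sub_apply, e1, e2]
    rw [kU, kV]
    linear_combination (-w 0 s) * hI
  · simp only [core, Fin.mk_one, Matrix.cons_val_one, Matrix.cons_val_fin_one, indicator_of_mem h1,
      indicator_of_mem h2, Pi.add_apply, Pi.sub_apply, e1, e2]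
    rw [kU, kV]
    linear_combination w 1 s * hexp

theorem core_add (a : ℝ) (p q p' q' : ℝ → ℂ) (j : Fin 2) (s : ℝ) :
    core a (fun x => p x + p' x) (fun x => q x + q' x) j s
      = core a p q j s + core a p' q' j s := by
  fin_cases j
  · simp only [core, Fin.zero_eta, Matrix.cons_val_zero]
    ring
  · simp only [core, Fin.mk_one, Matrix.cons_val_one, Matrix.cons_val_fin_one]
    ring

theorem core_ae_eq_zero (ha : 0 ≤ a) (hp : p =ᵐ[volume.restrict (Ioo 0 Real.pi)] 0)
    (hq : q =ᵐ[volume.restrict (Ioo 0 Real.pi)] 0) (j : Fin 2) :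
    core a p q j =ᵐ[volume.restrict (Ioo (-(Real.pi - a)) (Real.pi - a))] 0 := by
  have hp' : ∀ᵐ x ∂(volume.restrict (Ioo a Real.pi)), p x = 0 ∧ q x = 0 :=
    ae_restrict_of_ae_restrict_of_subset (Ioo_subset_Ioo_left ha) (hp.and hq)
  filter_upwards [ae_comp_mul_add (by norm_num) (mem_Ioo_iff_half_mul_add a) hp',
    ae_comp_mul_add (by norm_num) (mem_Ioo_iff_neg_half_mul_add a) hp'] with s h1 h2
  fin_cases j
  · simp only [core, Fin.zero_eta, Matrix.cons_val_zero, h1.1, h1.2, h2.1, h2.2]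
    simp
  · simp only [core, Fin.mk_one, Matrix.cons_val_one, Matrix.cons_val_fin_one, h1.1, h1.2, h2.1,
      h2.2]
    simp

theorem ae_eq_of_core_ae_eq {p' q' : ℝ → ℂ} (hp : IsPotential a p)
    (hq : IsPotential a q) (hp' : IsPotential a p') (hq' : IsPotential a q')
    (h : ∀ j, core a p q j =ᵐ[volume.restrict (Ioo (-(Real.pi - a)) (Real.pi - a))]
      core a p' q' j) :
    p =ᵐ[volume.restrict (Ioo 0 Real.pi)] p' ∧ q =ᵐ[volume.restrict (Ioo 0 Real.pi)] q' := by
  have hUV : ∀ᵐ s ∂(volume.restrict (Ioo (-(Real.pi - a)) (Real.pi - a))),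
      (p (1 / 2 * s + (Real.pi + a) / 2) + Complex.I * q (1 / 2 * s + (Real.pi + a) / 2)
        = p' (1 / 2 * s + (Real.pi + a) / 2) + Complex.I * q' (1 / 2 * s + (Real.pi + a) / 2)) ∧
      (p (-(1 / 2) * s + (Real.pi + a) / 2) - Complex.I * q (-(1 / 2) * s + (Real.pi + a) / 2)
        = p' (-(1 / 2) * s + (Real.pi + a) / 2)
          - Complex.I * q' (-(1 / 2) * s + (Real.pi + a) / 2)) := by
    filter_upwards [h 0, h 1] with s h0 h1
    simp only [core, Matrix.cons_val_zero, Matrix.cons_val_one, Matrix.cons_val_fin_one] at h0 h1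
    have h2 := mul_left_cancel₀ (by norm_num) (mul_right_cancel₀ (Complex.exp_ne_zero _) h1)
    have h3 := mul_left_cancel₀ (neg_ne_zero.2 (div_ne_zero Complex.I_ne_zero two_ne_zero)) h0
    constructor
    · linear_combination h2 + h3
    · linear_combination h2 - h3
  have hu : ∀ᵐ t ∂(volume.restrict (Ioo a Real.pi)),
      p t + Complex.I * q t = p' t + Complex.I * q' t := by
    filter_upwards [ae_comp_mul_add (c := 2) (d := -(Real.pi + a)) (T := Ioo a Real.pi)
      two_ne_zero (fun t => by
        simp only [mem_Ioo]; constructor <;> rintro ⟨h1, h2⟩ <;> constructor <;> linarith) hUV]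
      with t ht
    rw [show 1 / 2 * (2 * t + -(Real.pi + a)) + (Real.pi + a) / 2 = t by ring] at ht
    exact ht.1
  have hv : ∀ᵐ t ∂(volume.restrict (Ioo a Real.pi)),
      p t - Complex.I * q t = p' t - Complex.I * q' t := by
    filter_upwards [ae_comp_mul_add (c := -2) (d := Real.pi + a) (T := Ioo a Real.pi)
      (by norm_num) (fun t => by
        simp only [mem_Ioo]; constructor <;> rintro ⟨h1, h2⟩ <;> constructor <;> linarith) hUV]
      with t ht
    rw [show -(1 / 2) * (-2 * t + (Real.pi + a)) + (Real.pi + a) / 2 = t by ring] at ht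
    exact ht.2
  have key : ∀ᵐ x ∂(volume.restrict (Ioo 0 Real.pi)), p x = p' x ∧ q x = q' x := by
    have hne : ∀ᵐ x : ℝ, x ≠ a := by simp [ae_iff, measure_singleton]
    rw [ae_restrict_iff' measurableSet_Ioo] at hu hv ⊢
    filter_upwards [hu, hv, (ae_restrict_iff' measurableSet_Ioo).1 hp.2,
      (ae_restrict_iff' measurableSet_Ioo).1 hq.2, (ae_restrict_iff' measurableSet_Ioo).1 hp'.2,
      (ae_restrict_iff' measurableSet_Ioo).1 hq'.2, hne] with x h1 h2 h3 h4 h5 h6 hxa hx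
    rcases lt_or_gt_of_ne hxa with hlt | hgt
    · have hx' : x ∈ Ioo 0 a := ⟨hx.1, hlt⟩
      rw [h3 hx', h4 hx', h5 hx', h6 hx']
      exact ⟨rfl, rfl⟩
    · have hx' : x ∈ Ioo a Real.pi := ⟨hgt, hx.2⟩
      have e1 := h1 hx'
      have e2 := h2 hx'
      refine ⟨by linear_combination (e1 + e2) / 2, ?_⟩
      have e3 : Complex.I * q x = Complex.I * q' x := by linear_combination (e1 - e2) / 2
      exact mul_left_cancel₀ Complex.I_ne_zero e3
  exact ⟨key.mono fun x hx => hx.1, key.mono fun x hx => hx.2⟩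

end Core

end DelayDirac

namespace DelayDirac

open Filter Topology

/-! ### Completeness of exponentials as a uniqueness property of transforms. -/

section Completeness

variable {a : ℝ} {n : ℤ → ℤ}

theorem inner_expL2 (haπ : a < Real.pi) (m : ℤ)
    (x : Lp ℂ 2 (volume.restrict (Ioo (a - Real.pi) (Real.pi - a)))) :
    inner ℂ (expL2 a m) x
      = (starRingEnd ℂ) (ft (Real.pi - a) (fun s => (starRingEnd ℂ) (x s)) m) := by
  rw [L2.inner_def, ft, intervalIntegral.integral_of_le (by linarith),
    integral_Ioc_eq_integral_Ioo, ← integral_conj, neg_sub]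
  refine integral_congr_ae ?_
  filter_upwards [(memLp_exp a m).coeFn_toLp] with s hs
  rw [expL2, hs]
  simp

/-- In a Hilbert space density of the span means a trivial orthogonal complement. The inner product
is antilinear in one slot, so elements of the complement correspond to the conjugates of the
functions `w`. -/
theorem isCompleteExp_iff (haπ : a < Real.pi) :
    IsCompleteExp a n ↔ ∀ w : ℝ → ℂ,
      MemLp w 2 (volume.restrict (Ioo (-(Real.pi - a)) (Real.pi - a))) →
      (∀ k, ft (Real.pi - a) w (n k) = 0) →
      w =ᵐ[volume.restrict (Ioo (-(Real.pi - a)) (Real.pi - a))] 0 := by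
  have hb : 0 ≤ Real.pi - a := by linarith
  have hmem : ∀ x : Lp ℂ 2 (volume.restrict (Ioo (a - Real.pi) (Real.pi - a))),
      x ∈ (Submodule.span ℂ (range fun k : ℤ => expL2 a (n k)))ᗮ ↔
        ∀ k, ft (Real.pi - a) (fun s => (starRingEnd ℂ) (x s)) (n k) = 0 := by
    intro x
    rw [Submodule.mem_orthogonal]
    constructor
    · intro h k
      have := h _ (Submodule.subset_span ⟨k, rfl⟩)
      rw [inner_expL2 haπ] at this
      simpa using this
    · intro h u hu
      induction hu using Submodule.span_induction with
      | mem u hu =>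
        obtain ⟨k, rfl⟩ := hu
        rw [inner_expL2 haπ, h, map_zero]
      | zero => exact inner_zero_left _
      | add u v _ _ h1 h2 => rw [inner_add_left, h1, h2, add_zero]
      | smul c u _ h1 => rw [inner_smul_left, h1, mul_zero]
  rw [IsCompleteExp, Submodule.topologicalClosure_eq_top_iff, neg_sub]
  constructor
  · intro h w hw h0
    have hws : MemLp (fun s => (starRingEnd ℂ) (w s)) 2
      (volume.restrict (Ioo (a - Real.pi) (Real.pi - a))) := hw.star
    have h1 : hws.toLp _ ∈ (Submodule.span ℂ (range fun k : ℤ => expL2 a (n k)))ᗮ := by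
      rw [hmem]
      intro k
      have h2 : (fun s => (starRingEnd ℂ) (hws.toLp _ s))
          =ᵐ[volume.restrict (Ioo (-(Real.pi - a)) (Real.pi - a))] w := by
        rw [neg_sub]
        filter_upwards [hws.coeFn_toLp] with s hs
        rw [hs, Complex.conj_conj]
      rw [ft_congr_ae h2 hb, h0]
    rw [h, Submodule.mem_bot] at h1
    have h2 := hws.coeFn_toLp
    rw [h1] at h2
    filter_upwards [h2, Lp.coeFn_zero ℂ 2 (volume.restrict (Ioo (a - Real.pi) (Real.pi - a)))]
      with s hs hs0
    rw [hs0] at hs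
    simpa using hs.symm
  · intro h
    rw [eq_bot_iff]
    intro x hx
    rw [hmem] at hx
    have h1 := h _ (Lp.memLp x).star hx
    rw [Submodule.mem_bot, Lp.eq_zero_iff_ae_eq_zero]
    filter_upwards [h1] with s hs
    simpa using hs

end Completeness

/-! ### Both directions for a single function `sineType b w`. -/

section Uniqueness

variable {a : ℝ} {n : ℤ → ℤ} {b : ℝ} {w w' : ℝ → ℂ} {lam lam' : ℤ → ℂ}

theorem IsZeroSequence.congr (hb : 0 ≤ b) (h : IsZeroSequence b w lam)
    (hw : w =ᵐ[volume.restrict (Ioo (-b) b)] w') : IsZeroSequence b w' lam := by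
  have : sineType b w = sineType b w' := by
    ext z
    rw [sineType, sineType, ft_congr_ae hw hb]
  rwa [IsZeroSequence, ← this]

theorem summable_sq_comp (hn : Function.Injective n) (h : Summable fun m : ℤ => ‖lam m - m‖ ^ 2) :
    Summable fun k => ‖lam (n k) - n k‖ ^ 2 := h.comp_injective hn

theorem IsZeroSequence.encard_comp_le (h : IsZeroSequence b w lam) (hn : Function.Injective n)
    (z : ℂ) : {k | lam (n k) = z}.encard ≤ analyticOrderAt (sineType b w) z := by
  rw [← h.1 z, ← hn.encard_image]
  refine encard_le_encard ?_
  rintro _ ⟨k, hk, rfl⟩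
  exact hk

/-- A subsequence of zeros along frequencies that are complete determines the function. -/
theorem ae_eq_of_isZeroSequence (hb : 0 ≤ b) (hbπ : b ≤ Real.pi) (hn : Function.Injective n)
    (hcomplete : ∀ v : ℝ → ℂ, MemLp v 2 (volume.restrict (Ioo (-b) b)) →
      (∀ k, ft b v (n k) = 0) → v =ᵐ[volume.restrict (Ioo (-b) b)] 0)
    (hw : MemLp w 2 (volume.restrict (Ioo (-b) b)))
    (hw' : MemLp w' 2 (volume.restrict (Ioo (-b) b)))
    (h : IsZeroSequence b w lam) (h' : IsZeroSequence b w' lam')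
    (heq : ∀ k, lam (n k) = lam' (n k)) : w =ᵐ[volume.restrict (Ioo (-b) b)] w' := by
  have hwi := intervalIntegrable_of_memLp hw hb
  have hwi' := intervalIntegrable_of_memLp hw' hb
  by_contra hne
  have hne' : ¬ (fun s => w s - w' s) =ᵐ[volume.restrict (Ioo (-b) b)] 0 := fun h0 => hne <| by
    filter_upwards [h0] with s hs
    exact sub_eq_zero.1 hs
  have hord (z : ℂ) : {k | lam (n k) = z}.encard
      ≤ analyticOrderAt (ft b fun s => w s - w' s) z := by
    have h1 : ft b (fun s => w s - w' s) = sineType b w - sineType b w' := by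
      ext t
      rw [ft_sub hwi hwi', Pi.sub_apply, sineType, sineType]
      ring
    rw [h1]
    refine (le_min (h.encard_comp_le hn z) ?_).trans le_analyticOrderAt_sub
    simp only [heq]
    exact h'.encard_comp_le hn z
  -- The target frequencies are the integers `n k` themselves, so their deviations are zero.
  have h0 : Summable fun k => ‖((n k : ℤ) : ℂ) - n k‖ ^ 2 := by
    simp [summable_zero]
  obtain ⟨v, hv, hv0, hvn⟩ := exists_ft_vanishing_of_summable_sq hb hbπ hn
    (summable_sq_comp hn h.2) h0 (hw.sub hw') hne' hord
  refine hv0 (hcomplete v hv fun k => apply_eq_zero_of_analyticOrderAt_ne_zero fun h0 => ?_)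
  have h1 := hvn (n k)
  rw [h0, nonpos_iff_eq_zero, encard_eq_zero] at h1
  exact (eq_empty_iff_forall_notMem.1 h1) k rfl

/-- If the frequencies are not complete, a function is not determined by the corresponding
subsequence of zeros. -/
theorem IsZeroSequence.exists_add_of_incomplete (hb : 0 ≤ b) (hbπ : b < Real.pi)
    (hn : Function.Injective n) (hw : MemLp w 2 (volume.restrict (Ioo (-b) b)))
    (h : IsZeroSequence b w lam) {u : ℝ → ℂ}
    (hu : MemLp u 2 (volume.restrict (Ioo (-b) b))) (hun : ∀ k, ft b u (n k) = 0)
    (hu0 : ¬ u =ᵐ[volume.restrict (Ioo (-b) b)] 0) :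
    ∃ v : ℝ → ℂ, MemLp v 2 (volume.restrict (Ioo (-b) b)) ∧
      ¬ v =ᵐ[volume.restrict (Ioo (-b) b)] 0 ∧
      ∃ lam' : ℤ → ℂ, IsZeroSequence b (fun s => w s + v s) lam' ∧
        ∀ k, lam' (n k) = lam (n k) := by
  -- The `n k` are distinct, so a zero of order at least one at each of them is all that is
  -- required.
  have hord (z : ℂ) : {k | (n k : ℂ) = z}.encard ≤ analyticOrderAt (ft b u) z := by
    by_cases hz : ∃ k, (n k : ℂ) = z
    · obtain ⟨k, rfl⟩ := hz
      have h1 : {k' | (n k' : ℂ) = n k} = {k} := by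
        ext k'
        simpa using hn.eq_iff
      rw [h1, encard_singleton, Order.one_le_iff_ne_zero]
      exact ((analyticAt_ft hb (intervalIntegrable_of_memLp hu hb) _).analyticOrderAt_ne_zero).2
        (hun k)
    · have h1 : {k | (n k : ℂ) = z} = ∅ :=
        eq_empty_iff_forall_notMem.2 fun k hk => hz ⟨k, hk⟩
      rw [h1, encard_empty]
      exact zero_le
  have h0 : Summable fun k => ‖((n k : ℤ) : ℂ) - n k‖ ^ 2 := by
    simp [summable_zero]
  obtain ⟨v, hv, hv0, hvn⟩ := exists_ft_vanishing_of_summable_sq hb hbπ.le hn h0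
    (summable_sq_comp hn h.2) hu hu0 hord
  exact ⟨v, hv, hv0, exists_isZeroSequence_add hb hbπ hw hv h hn hvn⟩

end Uniqueness

end DelayDirac

/-! ### Assembly of the two directions for the boundary value problems. -/

theorem theorem2 (a : ℝ) (ha : Real.pi / 2 ≤ a) (haπ : a < Real.pi)
    (n : Fin 2 → ℤ → ℤ) (hn : ∀ j, StrictMono (n j))
    (p q : ℝ → ℂ) (hp : DelayDirac.IsPotential a p) (hq : DelayDirac.IsPotential a q)
    (μ : Fin 2 → ℤ → ℂ) (hμ : ∀ j, DelayDirac.IsSubspectrum a p q j (n j) (μ j)) :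
    (∀ p' q' : ℝ → ℂ, DelayDirac.IsPotential a p' → DelayDirac.IsPotential a q' →
        (∀ j, DelayDirac.IsSubspectrum a p' q' j (n j) (μ j)) →
        p' =ᵐ[MeasureTheory.volume.restrict (Set.Ioo 0 Real.pi)] p ∧
          q' =ᵐ[MeasureTheory.volume.restrict (Set.Ioo 0 Real.pi)] q) ↔
      ∀ j, DelayDirac.IsCompleteExp a (n j) := by
  have ha0 : 0 ≤ a := by linarith [Real.pi_pos]
  have hb : 0 ≤ Real.pi - a := by linarith
  have hbπ : Real.pi - a < Real.pi := by linarith [Real.pi_pos]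
  constructor
  · intro huniq j
    rw [DelayDirac.isCompleteExp_iff haπ]
    intro w hw hwn
    by_contra hw0
    obtain ⟨lam, hlam, hμlam⟩ := hμ j
    have hzero := (DelayDirac.isSpectrum_iff ha haπ hp hq).1 hlam
    obtain ⟨v, hv, hv0, lam', hlam', heq⟩ := hzero.exists_add_of_incomplete hb hbπ
      (hn j).injective (DelayDirac.memLp_core ha0 hp hq j) hw hwn hw0
    -- Only the `j`-th function is perturbed. The other one is unchanged almost everywhere, so its
    -- spectrum and subspectrum stay as they were.
    have hmem (i : Fin 2) : MeasureTheory.MemLp (if i = j then v else 0) 2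
        (MeasureTheory.volume.restrict (Set.Ioo (-(Real.pi - a)) (Real.pi - a))) := by
      split_ifs
      · exact hv
      · exact MeasureTheory.MemLp.zero
    obtain ⟨p₁, q₁, hp₁, hq₁, hcore⟩ := DelayDirac.exists_isPotential_core_eq ha0 hmem
    have hsum : ∀ i, ∀ s ∈ Set.Ioo (-(Real.pi - a)) (Real.pi - a),
        DelayDirac.core a (fun x => p x + p₁ x) (fun x => q x + q₁ x) i s
          = DelayDirac.core a p q i s + (if i = j then v else 0) s := fun i s hs => by
      rw [DelayDirac.core_add, hcore i s hs]
    have hsub (i : Fin 2) : DelayDirac.IsSubspectrum a (fun x => p x + p₁ x)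
        (fun x => q x + q₁ x) i (n i) (μ i) := by
      by_cases hij : i = j
      · subst hij
        refine ⟨fun m => lam' m - (i : ℕ) / 2,
          (DelayDirac.isSpectrum_iff ha haπ (hp.add hp₁) (hq.add hq₁)).2 ?_, fun k => ?_⟩
        · simp only [sub_add_cancel]
          refine hlam'.congr hb ((MeasureTheory.ae_restrict_iff' measurableSet_Ioo).2
            (Filter.Eventually.of_forall fun s hs => ?_))
          rw [hsum i s hs, if_pos rfl]
        · simp only [heq, add_sub_cancel_right, hμlam]
      · obtain ⟨lam₁, hlam₁, hμ₁⟩ := hμ i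
        refine ⟨lam₁, (DelayDirac.isSpectrum_iff ha haπ (hp.add hp₁) (hq.add hq₁)).2 ?_, hμ₁⟩
        refine ((DelayDirac.isSpectrum_iff ha haπ hp hq).1 hlam₁).congr hb
          ((MeasureTheory.ae_restrict_iff' measurableSet_Ioo).2
            (Filter.Eventually.of_forall fun s hs => ?_))
        rw [hsum i s hs, if_neg hij, Pi.zero_apply, add_zero]
    obtain ⟨hp', hq'⟩ := huniq _ _ (hp.add hp₁) (hq.add hq₁) hsub
    have hp₁0 : p₁ =ᵐ[MeasureTheory.volume.restrict (Set.Ioo 0 Real.pi)] 0 := by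
      filter_upwards [hp'] with x hx
      simpa using hx
    have hq₁0 : q₁ =ᵐ[MeasureTheory.volume.restrict (Set.Ioo 0 Real.pi)] 0 := by
      filter_upwards [hq'] with x hx
      simpa using hx
    refine hv0 ?_
    filter_upwards [DelayDirac.core_ae_eq_zero ha0 hp₁0 hq₁0 j,
      MeasureTheory.ae_restrict_mem measurableSet_Ioo] with s h1 hs
    rw [hcore j s hs, if_pos rfl] at h1
    exact h1
  · intro hcomplete p' q' hp' hq' hμ'
    refine DelayDirac.ae_eq_of_core_ae_eq hp' hq' hp hq fun j => ?_
    obtain ⟨lam, hlam, hμlam⟩ := hμ j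
    obtain ⟨lam', hlam', hμlam'⟩ := hμ' j
    refine DelayDirac.ae_eq_of_isZeroSequence hb hbπ.le (hn j).injective
      ((DelayDirac.isCompleteExp_iff haπ).1 (hcomplete j))
      (DelayDirac.memLp_core ha0 hp' hq' j) (DelayDirac.memLp_core ha0 hp hq j)
      ((DelayDirac.isSpectrum_iff ha haπ hp' hq').1 hlam')
      ((DelayDirac.isSpectrum_iff ha haπ hp hq).1 hlam) fun k => ?_
    simp only [← hμlam, ← hμlam']
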